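/- Let $\mathcal H$ be the Butcher--Connes--Kreimer Hopf algebra over $\mathbb R$: the free commutative algebra on the (non-empty, unlabelled, non-planar) rooted trees, with the empty tree $\emptyset$ as unit, with coproduct $\Delta(\tau)=\tau\otimes\emptyset+\sum_c P_c(\tau)\otimes R_c(\tau)$, where $c$ runs over the admissible sets of edges of $\tau$ (at most one edge on each path from the root to a leaf; the empty set is included), $R_c(\tau)$ is the component of the root after deletion of $c$, and $P_c(\tau)$ is the product of the other components, and with antipode $S(\tau)=\sum_{c\subseteq E(\tau)}(-1)^{|c|+1}\tau^c$, where $\tau^c$ is the product of the components of $\tau$ after deletion of $c$. Let $\mu$ be the multiplication, $|\tau|$ the number of vertices of $\tau$, $\bar S(\tau)=(-1)^{|\tau|}S(\tau)$, and let $\mathrm{Id}^{1/2}$ be the unique multiplicative map $\phi:\mathcal H\to\mathcal H$ with $\mu\circ(\phi\otimes\phi)\circ\Delta=\mathrm{Id}$. Define multiplicative maps on $\mathcal H$ by $$\tau^-=\mu\circ(\bar S\otimes\mathrm{Id})\circ\Delta\circ\mathrm{Id}^{1/2}(\tau),\qquad \tau^+=\mu\circ(\mathrm{Id}\otimes((\cdot)^-\circ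 S))\circ\Delta(\tau).$$ For an $s$-stage Runge--Kutta scheme with real matrix $A=(a_{ij})$ and weights $b=(b_i)$, and nodes $c_i=\sum_j a_{ij}$, let $\psi:\mathcal H\to\mathbb R$ be the multiplicative linear extension of its elementary weights $\psi(\tau)=\sum_i b_i\,(\psi_iD)(\tau)$, where $(\psi_iD)([\tau_1,\dots,\tau_k])=\prod_{l=1}^k\sum_j a_{ij}(\psi_jD)(\tau_l)$. Here $[\tau_1,\dots,\tau_k]$ is the tree obtained by joining the roots of $\tau_1,\dots,\tau_k$ to a new root ($k=0$ gives the one-vertex tree). With the tree factorial $[\tau_1,\dots,\tau_k]!=|[\tau_1,\dots,\tau_k]|\,\tau_1!\cdots\tau_k!$, let $$\mathrm{ord}(\psi)=\sup\{n\in\mathbb N:\psi(\tau)=1/\tau!\ \text{ for all } \tau \text{ with } 1\le|\tau|\le n\},$$ $$\mathrm{ord}^+(\psi)=\sup\{n\in\mathbb N:\psi(\tau^+)=0\ \text{ for all } \tau \text{ with } 1\le|\tau|\le n\}.$$ The class $\mathrm{EES}(n,m)$ consists of the explicit schemes ($a_{ij}=0$ for $i\le j$) with $\mathrm{ord}(\psi)=n$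 and $\mathrm{ord}^+(\psi)=m$ (both exactly). **Proposition.** A $3$-stage Runge--Kutta scheme belongs to $\mathrm{EES}(2,5)$ if and only if, for some $x\in\mathbb R$ with $x\ne1$ and $x\neq\pm\tfrac12$, it is the scheme $\mathrm{EES}(2,5;x)$ with Butcher tableau $$\begin{array}{c|ccc}0&&&\\ \frac{1+2x}{4(1-x)}&\frac{1+2x}{4(1-x)}&&\\ \frac{3}{4(1-x)}&\frac{(4x-1)^2}{4(x-1)(1-4x^2)}&\frac{1-x}{1-4x^2}&\\ \hline &x&\frac12&\frac12-x\end{array}$$ In particular, $\mathrm{EES}(2,5;\tfrac14)$ and $\mathrm{EES}(2,5;\tfrac1{10})$ are the schemes $$\begin{array}{c|ccc}0&&&\\ \frac12&\frac12&&\\ 1&0&1&\\ \hline&\frac14&\frac12&\frac14\end{array}\qquad\text{and}\qquad\begin{array}{c|ccc}0&&&\\ \frac13&\frac13&&\\ \frac56&-\frac5{48}&\frac{15}{16}&\\ \hline&\frac1{10}&\frac12&\frac25\end{array}$$ -/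

import Mathlib

open scoped TensorProduct

namespace EES

/-! ### Non-planar rooted trees -/

/-- Planar (ordered) non-empty rooted trees: `dot` is the one-vertex tree, and `graft t u` is the
tree obtained from `u` by joining the root of `t` to the root of `u` as a new first child.
Every planar rooted tree is obtained in exactly one way. -/
inductive PTree : Type
  | dot : PTree
  | graft : PTree → PTree → PTree

/-- Two planar trees are isomorphic as (non-planar) rooted trees: the congruence generated by
exchanging two neighbouring children of a vertex. -/
inductive PTree.Iso : PTree → PTree → Prop
  | refl (t : PTree) : PTree.Iso t t
  | symm {t u : PTree} : PTree.Iso t u → PTree.Iso u t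
  | trans {t u v : PTree} : PTree.Iso t u → PTree.Iso u v → PTree.Iso t v
  | congr {t t' u u' : PTree} : PTree.Iso t t' → PTree.Iso u u' →
      PTree.Iso (PTree.graft t u) (PTree.graft t' u')
  | swap (t u v : PTree) :
      PTree.Iso (PTree.graft t (PTree.graft u v)) (PTree.graft u (PTree.graft t v))

instance PTree.setoid : Setoid PTree where
  r := PTree.Iso
  iseqv := ⟨PTree.Iso.refl, PTree.Iso.symm, PTree.Iso.trans⟩

/-- The set of non-empty unlabelled non-planar rooted trees.  The empty tree is the unit of the
algebra `H` below. -/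
def RTree : Type := Quotient PTree.setoid

/-- Forests: finite multisets of non-empty rooted trees. -/
abbrev Forest : Type := Multiset RTree

namespace RTree

/-- The one-vertex tree. -/
def dot : RTree := Quotient.mk PTree.setoid PTree.dot

/-- Join the root of the first tree, as a new child, to the root of the second. -/
def graft : RTree → RTree → RTree :=
  Quotient.map₂ PTree.graft fun _ _ h _ _ k => PTree.Iso.congr h k

instance graft_leftCommutative : LeftCommutative graft where
  left_comm := by
    rintro ⟨t⟩ ⟨u⟩ ⟨v⟩
    exact Quotient.sound (PTree.Iso.swap t u v)

/-- `node {τ₁, …, τₖ} = [τ₁, …, τₖ]`: join the roots of the trees of a forest to a new root. -/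
def node (F : Forest) : RTree := F.foldr graft dot

theorem node_zero : node 0 = dot := rfl

theorem node_cons (t : RTree) (F : Forest) : node (t ::ₘ F) = graft t (node F) :=
  Multiset.foldr_cons graft dot t F

end RTree

/-- The values of a function `f` on the trees hanging off the root, where `f` is given recursively
by `f [τ₁, …, τₖ] = g {f τ₁, …, f τₖ}`. -/
def PTree.foldChildren {α : Type} (g : Multiset α → α) : PTree → Multiset α
  | PTree.dot => 0
  | PTree.graft t u => g (PTree.foldChildren g t) ::ₘ PTree.foldChildren g u

theorem PTree.foldChildren_congr {α : Type} (g : Multiset α → α) {t u : PTree}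
    (h : PTree.Iso t u) : t.foldChildren g = u.foldChildren g := by
  induction h with
  | refl t => rfl
  | symm _ ih => exact ih.symm
  | trans _ _ ih₁ ih₂ => exact ih₁.trans ih₂
  | congr _ _ ih₁ ih₂ => simp only [PTree.foldChildren, ih₁, ih₂]
  | swap t u v => exact Multiset.cons_swap _ _ _

namespace RTree

def foldChildren {α : Type} (g : Multiset α → α) : RTree → Multiset α :=
  Quotient.lift (PTree.foldChildren g) fun _ _ h => PTree.foldChildren_congr g h

/-- The function `f` on trees with `f [τ₁, …, τₖ] = g {f τ₁, …, f τₖ}`. -/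
def fold {α : Type} (g : Multiset α → α) (τ : RTree) : α := g (foldChildren g τ)

theorem foldChildren_node {α : Type} (g : Multiset α → α) (F : Forest) :
    foldChildren g (node F) = F.map (fold g) := by
  induction F using Multiset.induction_on with
  | empty => rfl
  | cons t F ih =>
    rw [node_cons, Multiset.map_cons, ← ih]
    generalize node F = u
    induction t using Quotient.inductionOn
    induction u using Quotient.inductionOn
    rfl

theorem fold_node {α : Type} (g : Multiset α → α) (F : Forest) :
    fold g (node F) = g (F.map (fold g)) := by
  rw [fold, foldChildren_node]

theorem node_induction {p : RTree → Prop} (h : ∀ F : Forest, (∀ t ∈ F, p t) → p (node F))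
    (τ : RTree) : p τ := by
  suffices H : ∃ F : Forest, node F = τ ∧ ∀ t ∈ F, p t by
    obtain ⟨F, rfl, hF⟩ := H
    exact h F hF
  induction τ using Quotient.inductionOn with
  | h t =>
    induction t with
    | dot => exact ⟨0, rfl, by simp⟩
    | graft t u iht ihu =>
      obtain ⟨F, hF, hp⟩ := iht
      obtain ⟨G, hG, hq⟩ := ihu
      refine ⟨node F ::ₘ G, ?_, ?_⟩
      · rw [node_cons, hF, hG]
        rfl
      · intro s hs
        rcases Multiset.mem_cons.1 hs with rfl | hs
        · exact h F hp
        · exact hq s hs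

/-- The function `f` on trees with `f [τ₁, …, τₖ] = g {(τ₁, f τ₁), …, (τₖ, f τₖ)}`. -/
def para {α : Type} (g : Multiset (RTree × α) → α) (τ : RTree) : α :=
  (fold (fun s => (node (s.map Prod.fst), g s)) τ).2

theorem para_node {α : Type} (g : Multiset (RTree × α) → α) (F : Forest) :
    para g (node F) = g (F.map fun t => (t, para g t)) := by
  have key : ∀ t : RTree, fold (fun s => (node (s.map Prod.fst), g s)) t = (t, para g t) := by
    intro t
    refine Prod.ext ?_ rfl
    induction t using node_induction with
    | h F ih =>
      rw [fold_node]
      simp only [Multiset.map_map, Function.comp_apply]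
      rw [Multiset.map_congr rfl ih, Multiset.map_id']
  unfold para
  rw [fold_node]
  simp only [key]

/-- The number of vertices `|τ|`. -/
def size : RTree → ℕ := fold fun s => s.sum + 1

theorem size_node (F : Forest) : size (node F) = (F.map size).sum + 1 := fold_node _ F

/-- The tree factorial `[τ₁, …, τₖ]! = |[τ₁, …, τₖ]| · τ₁! ⋯ τₖ!`. -/
def factorial : RTree → ℕ :=
  para fun s => size (node (s.map Prod.fst)) * (s.map Prod.snd).prod

/-- The admissible cuts of `τ` other than the total cut (the empty cut is included), listed with
multiplicity as the pairs `(P, R)` of the pruned forest and the trunk containing the root.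
For each child `t` of the root one either cuts the edge above `t` (then `t` falls into `P` and no
further edge of `t` may be cut), or chooses an admissible cut of `t`.  `Multiset.Sections` lists
the ways to make one choice for each child. -/
def admissibleCuts : RTree → Multiset (Forest × RTree) :=
  para fun s =>
    (Multiset.Sections (s.map fun p =>
      (({p.1}, 0) : Forest × Forest) ::ₘ p.2.map fun c => (c.1, {c.2}))).map
        fun ch => ((ch.map Prod.fst).sum, node (ch.map Prod.snd).sum)

/-- All sets `c` of edges of `τ`, listed as the triples `(|c|, R, P)` of the number of edges of
`c`, the component `R` of the root in `τ` without the edges of `c`, and the forest `P` of the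
other components.  For each child `t` of the root one chooses a set of edges of `t`, and then
keeps or removes the edge above `t`. -/
def edgeCuts : RTree → Multiset (ℕ × RTree × Forest) :=
  para fun s =>
    (Multiset.Sections (s.map fun p =>
      (p.2.map fun c => ((c.1, {c.2.1}, c.2.2) : ℕ × Forest × Forest)) +
        p.2.map fun c => (c.1 + 1, 0, c.2.1 ::ₘ c.2.2))).map
          fun ch => ((ch.map fun x => x.1).sum, node (ch.map fun x => x.2.1).sum,
            (ch.map fun x => x.2.2).sum)

open Classical in
/-- The admissible cuts other than the empty cut and the total cut. -/
noncomputable def properCuts (τ : RTree) : Multiset (Forest × RTree) :=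
  (admissibleCuts τ).filter fun c => c.1 ≠ 0

theorem size_pos (τ : RTree) : 0 < size τ := Nat.succ_pos _

theorem size_of_mem_admissibleCuts (τ : RTree) :
    ∀ c ∈ admissibleCuts τ, (c.1.map size).sum + size c.2 = size τ := by
  induction τ using node_induction with
  | h F ih =>
    intro c hc
    rw [admissibleCuts, para_node, Multiset.mem_map] at hc
    obtain ⟨ch, hch, rfl⟩ := hc
    rw [size_node, size_node, ← add_assoc]
    congr 1
    rw [Multiset.map_map] at hch
    induction F using Multiset.induction_on generalizing ch with
    | empty =>
      simp only [Multiset.map_zero, Multiset.sections_zero, Multiset.mem_singleton] at hch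
      subst hch
      simp
    | cons t F ihF =>
      rw [Multiset.map_cons, Multiset.sections_cons, Multiset.mem_bind] at hch
      obtain ⟨x, hx, hch⟩ := hch
      rw [Multiset.mem_map] at hch
      obtain ⟨ch, hch, rfl⟩ := hch
      have h1 := ihF (fun t ht => ih t (Multiset.mem_cons_of_mem ht)) ch hch
      have h2 : (x.1.map size).sum + (x.2.map size).sum = size t := by
        rcases Multiset.mem_cons.1 hx with rfl | hx
        · simp
        · rw [Multiset.mem_map] at hx
          obtain ⟨c, hc, rfl⟩ := hx
          have := ih t (Multiset.mem_cons_self t F) c hc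
          simpa using this
      rw [Multiset.map_cons, Multiset.sum_cons, Multiset.map_cons, Multiset.sum_cons,
        Multiset.map_cons, Multiset.sum_cons, Multiset.map_add, Multiset.sum_add,
        Multiset.map_add, Multiset.sum_add]
      dsimp only at h1 ⊢
      omega

theorem size_trunk_lt {τ : RTree} {c : Forest × RTree} (hc : c ∈ properCuts τ) :
    size c.2 < size τ := by
  classical
  obtain ⟨h, h0⟩ := Multiset.mem_filter.1 hc
  have h1 := size_of_mem_admissibleCuts τ c h
  obtain ⟨t, ht⟩ := Multiset.exists_mem_of_ne_zero h0
  have h2 := Multiset.single_le_sum (fun _ _ => Nat.zero_le _) _ (Multiset.mem_map_of_mem size ht)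
  have h3 := size_pos t
  omega

theorem size_pruned_lt {τ : RTree} {c : Forest × RTree} (hc : c ∈ properCuts τ) {t : RTree}
    (ht : t ∈ c.1) : size t < size τ := by
  classical
  obtain ⟨h, -⟩ := Multiset.mem_filter.1 hc
  have h1 := size_of_mem_admissibleCuts τ c h
  have h2 := Multiset.single_le_sum (fun _ _ => Nat.zero_le _) _ (Multiset.mem_map_of_mem size ht)
  have h3 := size_pos c.2
  omega

end RTree

/-! ### The Butcher-Connes-Kreimer Hopf algebra -/

/-- The free commutative `ℝ`-algebra on the non-empty rooted trees; its unit is the empty tree. -/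
abbrev H : Type := MvPolynomial RTree ℝ

/-- A tree as an element of `H`. -/
noncomputable abbrev tree (τ : RTree) : H := MvPolynomial.X τ

/-- A forest as an element of `H`: the product of its trees. -/
noncomputable def forest (F : Forest) : H := (F.map tree).prod

/-- The coproduct, `Δ τ = τ ⊗ ∅ + ∑ P_c(τ) ⊗ R_c(τ)`; the first summand is the total cut. -/
noncomputable def coproduct : H →ₐ[ℝ] H ⊗[ℝ] H :=
  MvPolynomial.aeval fun τ =>
    tree τ ⊗ₜ[ℝ] (1 : H) +
      ((RTree.admissibleCuts τ).map fun c => forest c.1 ⊗ₜ[ℝ] tree c.2).sum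

/-- The antipode, `S τ = ∑ (-1)^(|c| + 1) τ^c` over all sets `c` of edges of `τ`. -/
noncomputable def antipode : H →ₐ[ℝ] H :=
  MvPolynomial.aeval fun τ =>
    ((RTree.edgeCuts τ).map fun c => (-1 : H) ^ (c.1 + 1) * (tree c.2.1 * forest c.2.2)).sum

/-- The canonical involution `τ ↦ (-1)^|τ| τ`. -/
noncomputable def involution : H →ₐ[ℝ] H :=
  MvPolynomial.aeval fun τ => (-1 : H) ^ RTree.size τ * tree τ

/-- The convolution product `μ ∘ (f ⊗ g) ∘ Δ` of multiplicative maps. -/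
noncomputable def conv (f g : H →ₐ[ℝ] H) : H →ₐ[ℝ] H :=
  (Algebra.TensorProduct.productMap f g).comp coproduct

/-- The values on trees of the convolution square root `φ = Id^(1/2)` of the identity map, given
by `φ(τ) = (τ - ∑ φ(P_c(τ)) φ(R_c(τ))) / 2`, where `c` runs over the admissible cuts other than
the empty and the total cut. -/
noncomputable def sqrtIdTree (τ : RTree) : H :=
  (1 / 2 : ℝ) • (tree τ -
    ((RTree.properCuts τ).attach.map fun c =>
      (c.1.1.attach.map fun t => sqrtIdTree t.1).prod * sqrtIdTree c.1.2).sum)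
termination_by τ.size
decreasing_by
  · exact RTree.size_pruned_lt c.2 t.2
  · exact RTree.size_trunk_lt c.2

/-- The unique multiplicative map `Id^(1/2)` with `Id^(1/2) * Id^(1/2) = Id`
(convolution product). -/
noncomputable def sqrtId : H →ₐ[ℝ] H := MvPolynomial.aeval sqrtIdTree

/-- The map `τ ↦ τ⁻ = μ ∘ (S̄ ⊗ Id) ∘ Δ ∘ Id^(1/2)`, where `S̄ τ = (-1)^|τ| S τ`. -/
noncomputable def minus : H →ₐ[ℝ] H :=
  (conv (antipode.comp involution) (AlgHom.id ℝ H)).comp sqrtId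

/-- The map `τ ↦ τ⁺ = μ ∘ (Id ⊗ (·)⁻ ∘ S) ∘ Δ`. -/
noncomputable def plus : H →ₐ[ℝ] H :=
  conv (AlgHom.id ℝ H) (minus.comp antipode)

/-- The order of a character: the supremum of all `n` such that `ψ(τ) = 1 / τ!` for `|τ| ≤ n`. -/
noncomputable def order (ψ : H →ₐ[ℝ] ℝ) : ℕ∞ :=
  sSup {N : ℕ∞ | ∃ n : ℕ, N = n ∧
    ∀ τ : RTree, τ.size ≤ n → ψ (tree τ) = 1 / (τ.factorial : ℝ)}

/-- The antisymmetric order of a character: the supremum of all `n` such that `ψ(τ⁺) = 0` for all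
non-empty trees `τ` with `|τ| ≤ n`. -/
noncomputable def antisymmetricOrder (ψ : H →ₐ[ℝ] ℝ) : ℕ∞ :=
  sSup {N : ℕ∞ | ∃ n : ℕ, N = n ∧ ∀ τ : RTree, τ.size ≤ n → ψ (plus (tree τ)) = 0}

/-! ### Runge-Kutta schemes -/

/-- An `s`-stage Runge-Kutta scheme, given by its matrix and its weights. -/
@[ext]
structure RKScheme (s : ℕ) where
  A : Matrix (Fin s) (Fin s) ℝ
  b : Fin s → ℝ

namespace RKScheme

variable {s : ℕ}

/-- The nodes `c_i = ∑_j a_ij`. -/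
def c (Ψ : RKScheme s) (i : Fin s) : ℝ := ∑ j, Ψ.A i j

/-- The scheme is explicit: its matrix is strictly lower triangular. -/
def IsExplicit (Ψ : RKScheme s) : Prop := ∀ i j : Fin s, i ≤ j → Ψ.A i j = 0

/-- The derivative weights: `(ψ_i D)([τ₁, …, τₖ]) = ∏ₗ ψ_i(τₗ)`, where the internal weights are
`ψ_i(τ) = ∑_j a_ij (ψ_j D)(τ)`. -/
noncomputable def derivativeWeight (Ψ : RKScheme s) : RTree → Fin s → ℝ :=
  RTree.fold fun F i => (F.map fun w => ∑ j, Ψ.A i j * w j).prod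

/-- The elementary weights `ψ(τ) = ∑_i b_i (ψ_i D)(τ)`, extended to a character of `H`. -/
noncomputable def character (Ψ : RKScheme s) : H →ₐ[ℝ] ℝ :=
  MvPolynomial.aeval fun τ => ∑ i, Ψ.b i * Ψ.derivativeWeight τ i

end RKScheme

/-- The `s`-stage members of the class `EES(n, m)`: explicit schemes of order exactly `n` and
antisymmetric order exactly `m`.  (For `n ≥ 1` the order condition on the one-vertex tree is the
consistency condition `∑ b_i = 1`.) -/
def EESClass (s n m : ℕ) : Set (RKScheme s) :=
  {Ψ | Ψ.IsExplicit ∧ order Ψ.character = n ∧ antisymmetricOrder Ψ.character = m}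

/-- The scheme `EES(2,5;x)`. -/
noncomputable def EES25 (x : ℝ) : RKScheme 3 where
  A := !![0, 0, 0;
          (1 + 2 * x) / (4 * (1 - x)), 0, 0;
          (4 * x - 1) ^ 2 / (4 * (x - 1) * (1 - 4 * x ^ 2)), (1 - x) / (1 - 4 * x ^ 2), 0]
  b := ![x, 1 / 2, 1 / 2 - x]

end EES

/-!
For a character `ψ` put `ψ̄(τ) = (-1)^|τ| ψ(τ)`. In the group of characters `ψ⁻` is the square root
of `ψ̄⁻¹ * ψ` and `ψ⁺ = ψ * (ψ⁻)⁻¹`. Square roots being unique in the Butcher group truncated at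
`n` vertices, `ψ⁺` vanishes on the trees with at most `n` vertices if and only if `ψ * ψ̄` does.
The identity `(ψ * ψ̄) * ψ = ψ * conj (ψ * ψ̄)`, where `conj ψ = ψ̄`, shows that a smallest tree on
which `ψ * ψ̄` does not vanish has an even number of vertices. Antisymmetric order at least five is
therefore a condition on the trees with two and four vertices only, and given order two it consists
of four polynomial equations in the coefficients. It is never exceeded by an explicit three-stage
scheme satisfying them: its character `ψ` vanishes on the ladders with more than three vertices, so
`ψ * ψ̄` takes on the ladder with six vertices the value `-ψ(ℓ)²`, where `ℓ` is the ladder with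
three vertices and `ψ(ℓ) = 1/8`. The equations are solved by elimination, with `x = b₁` as
parameter.
-/

namespace EES

namespace RTree

theorem exists_eq_node (τ : RTree) : ∃ F : Forest, τ = node F := by
  induction τ using node_induction with
  | h F _ => exact ⟨F, rfl⟩

/-- The admissible cuts of a tree together with its total cut.  The trunk is recorded as a forest,
which is empty for the total cut. -/
def fullCuts (t : RTree) : Multiset (Forest × Forest) :=
  ({t}, 0) ::ₘ (admissibleCuts t).map fun c => (c.1, {c.2})

/-- The ways to choose a full cut of every tree of a forest. -/
def forestCuts (F : Forest) : Multiset (Forest × Forest) :=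
  (Multiset.Sections (F.map fullCuts)).map Multiset.sum

theorem forestCuts_zero : forestCuts 0 = {0} := by simp [forestCuts]

theorem forestCuts_cons (t : RTree) (F : Forest) :
    forestCuts (t ::ₘ F) = (fullCuts t).bind fun c => (forestCuts F).map (c + ·) := by
  simp only [forestCuts, Multiset.map_cons, Multiset.sections_cons, Multiset.map_bind,
    Multiset.map_map, Function.comp_def, Multiset.sum_cons]

theorem admissibleCuts_node (F : Forest) :
    admissibleCuts (node F) = (forestCuts F).map fun c => (c.1, node c.2) := by
  have h_fst (s : Multiset (Forest × Forest)) : s.sum.1 = (s.map Prod.fst).sum :=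
    map_multiset_sum (AddMonoidHom.fst _ _) s
  have h_snd (s : Multiset (Forest × Forest)) : s.sum.2 = (s.map Prod.snd).sum :=
    map_multiset_sum (AddMonoidHom.snd _ _) s
  rw [admissibleCuts, para_node, forestCuts]
  simp only [Multiset.map_map, Function.comp_def, h_fst, h_snd]
  rfl

theorem exists_forestCuts_eq_cons (F : Forest)
    (hF : ∀ t ∈ F, ∃ s, admissibleCuts t = (0, t) ::ₘ s ∧ ∀ c ∈ s, c.1 ≠ 0) :
    ∃ s, forestCuts F = (0, F) ::ₘ s ∧ ∀ c ∈ s, c.1 ≠ 0 := by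
  induction F using Multiset.induction_on with
  | empty => exact ⟨0, forestCuts_zero, by simp⟩
  | cons t F ih =>
    obtain ⟨r, hr, hr0⟩ := hF t (Multiset.mem_cons_self t F)
    obtain ⟨s, hs, hs0⟩ := ih fun u hu => hF u (Multiset.mem_cons_of_mem hu)
    let cutFirst : Multiset (Forest × Forest) := ({t}, 0) ::ₘ r.map fun c => (c.1, {c.2})
    refine ⟨s.map ((0, {t}) + ·) + cutFirst.bind fun c => (forestCuts F).map (c + ·), ?_, ?_⟩
    · have h_full : fullCuts t = (0, {t}) ::ₘ cutFirst := by
        rw [fullCuts, hr, Multiset.map_cons, Multiset.cons_swap]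
      have h_keep : (forestCuts F).map ((0, {t}) + ·) = (0, t ::ₘ F) ::ₘ s.map ((0, {t}) + ·) := by
        rw [hs, Multiset.map_cons]
        simp
      rw [forestCuts_cons, h_full, Multiset.cons_bind, h_keep, Multiset.cons_add]
    · intro c hc
      simp only [cutFirst, Multiset.mem_add, Multiset.mem_map, Multiset.mem_bind,
        Multiset.mem_cons] at hc
      rcases hc with ⟨d, hd, rfl⟩ | ⟨x, rfl | ⟨d, hd, rfl⟩, e, -, rfl⟩
      · simpa using hs0 d hd
      · simp
      · simp [hr0 d hd]

theorem exists_admissibleCuts_eq_cons (τ : RTree) :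
    ∃ s, admissibleCuts τ = (0, τ) ::ₘ s ∧ ∀ c ∈ s, c.1 ≠ 0 := by
  induction τ using node_induction with
  | h F ih =>
    obtain ⟨s, hs, hs0⟩ := exists_forestCuts_eq_cons F ih
    refine ⟨s.map fun c => (c.1, node c.2), ?_, ?_⟩
    · rw [admissibleCuts_node, hs, Multiset.map_cons]
    · exact Multiset.forall_mem_map_iff.2 fun c hc => hs0 c hc

theorem admissibleCuts_eq_cons (τ : RTree) : admissibleCuts τ = (0, τ) ::ₘ properCuts τ := by
  classical
  obtain ⟨s, hs, hs0⟩ := exists_admissibleCuts_eq_cons τ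
  rw [properCuts, hs, Multiset.filter_cons_of_neg _ (by simp), Multiset.filter_eq_self.2 hs0]

/-- The sets of edges of the tree obtained by adding a new root below `t`, as triples of the
number of edges, the forest of the branches that stay joined to the new root, and the forest of the
components cut off. -/
def plantedEdgeCuts (t : RTree) : Multiset (ℕ × Forest × Forest) :=
  ((edgeCuts t).map fun c => (c.1, {c.2.1}, c.2.2)) +
    (edgeCuts t).map fun c => (c.1 + 1, 0, c.2.1 ::ₘ c.2.2)

/-- The ways to choose a planted edge cut of every tree of a forest. -/
def forestEdgeCuts (F : Forest) : Multiset (ℕ × Forest × Forest) :=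
  (Multiset.Sections (F.map plantedEdgeCuts)).map Multiset.sum

theorem forestEdgeCuts_zero : forestEdgeCuts 0 = {0} := by simp [forestEdgeCuts]

theorem forestEdgeCuts_cons (t : RTree) (F : Forest) :
    forestEdgeCuts (t ::ₘ F) =
      (plantedEdgeCuts t).bind fun c => (forestEdgeCuts F).map (c + ·) := by
  simp only [forestEdgeCuts, Multiset.map_cons, Multiset.sections_cons, Multiset.map_bind,
    Multiset.map_map, Function.comp_def, Multiset.sum_cons]

theorem edgeCuts_node (F : Forest) :
    edgeCuts (node F) = (forestEdgeCuts F).map fun c => (c.1, node c.2.1, c.2.2) := by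
  have h_fst {A B : Type} [AddCommMonoid A] [AddCommMonoid B] (s : Multiset (A × B)) :
      s.sum.1 = (s.map Prod.fst).sum :=
    map_multiset_sum (AddMonoidHom.fst A B) s
  have h_snd {A B : Type} [AddCommMonoid A] [AddCommMonoid B] (s : Multiset (A × B)) :
      s.sum.2 = (s.map Prod.snd).sum :=
    map_multiset_sum (AddMonoidHom.snd A B) s
  rw [edgeCuts, para_node, forestEdgeCuts]
  simp only [Multiset.map_map, Function.comp_def, h_fst, h_snd]
  rfl

end RTree

/-! ### The grafting operator -/

section Forest

variable {C : Type*} [CommSemiring C] [Algebra ℝ C]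

theorem forest_zero : forest 0 = 1 := by simp [forest]

theorem forest_singleton (t : RTree) : forest {t} = tree t := by simp [forest]

theorem forest_cons (t : RTree) (F : Forest) : forest (t ::ₘ F) = tree t * forest F := by
  simp [forest]

theorem forest_add (F G : Forest) : forest (F + G) = forest F * forest G := by
  simp [forest]

theorem map_forest (f : H →ₐ[ℝ] C) (F : Forest) :
    f (forest F) = (F.map fun t => f (tree t)).prod := by
  rw [forest, map_multiset_prod, Multiset.map_map]
  rfl

theorem forest_toMultiset (m : RTree →₀ ℕ) :
    forest (Finsupp.toMultiset m) = MvPolynomial.basisMonomials RTree ℝ m := by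
  rw [forest, Finsupp.toMultiset_map, Finsupp.prod_toMultiset,
    Finsupp.prod_mapDomain_index (by simp) (by simp [pow_add]), MvPolynomial.coe_basisMonomials]
  simp [MvPolynomial.monomial_eq]

theorem linearMap_ext_forest {V : Type*} [AddCommMonoid V] [Module ℝ V] {f g : H →ₗ[ℝ] V}
    (h : ∀ F : Forest, f (forest F) = g (forest F)) : f = g :=
  (MvPolynomial.basisMonomials RTree ℝ).ext fun m => by
    simpa only [forest_toMultiset] using h (Finsupp.toMultiset m)

/-- The grafting operator `B₊`: the linear map with `τ₁ ⋯ τₖ ↦ [τ₁, …, τₖ]`.  By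
`coproduct_bPlus` it is a Hochschild cocycle, which reduces identities between multiplicative maps
on `H` to the recursive structure of trees. -/
noncomputable def bPlus : H →ₗ[ℝ] H :=
  (MvPolynomial.basisMonomials RTree ℝ).constr ℝ fun m => tree (RTree.node (Finsupp.toMultiset m))

theorem bPlus_forest (F : Forest) : bPlus (forest F) = tree (RTree.node F) := by
  classical
  obtain ⟨m, rfl⟩ := (Multiset.toFinsupp (α := RTree)).symm.surjective F
  rw [Multiset.toFinsupp_symm_apply, forest_toMultiset, bPlus, Module.Basis.constr_basis]

theorem algHom_ext_bPlus {f g : H →ₐ[ℝ] C}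
    (h : ∀ y, f y = g y → f (bPlus y) = g (bPlus y)) : f = g := by
  refine MvPolynomial.algHom_ext fun τ => ?_
  induction τ using RTree.node_induction with
  | h F ih =>
    simp only [← bPlus_forest]
    refine h (forest F) ?_
    rw [map_forest, map_forest, Multiset.map_congr rfl ih]

theorem coproduct_tree (τ : RTree) :
    coproduct (tree τ) = tree τ ⊗ₜ[ℝ] (1 : H) +
      ((RTree.admissibleCuts τ).map fun c => forest c.1 ⊗ₜ[ℝ] tree c.2).sum :=
  MvPolynomial.aeval_X _ _

theorem coproduct_forest (F : Forest) :
    coproduct (forest F) =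
      ((RTree.forestCuts F).map fun c => forest c.1 ⊗ₜ[ℝ] forest c.2).sum := by
  induction F using Multiset.induction_on with
  | empty => simp [RTree.forestCuts_zero, forest_zero, Algebra.TensorProduct.one_def]
  | cons t F ih =>
    have h_tree : coproduct (tree t) =
        ((RTree.fullCuts t).map fun c => forest c.1 ⊗ₜ[ℝ] forest c.2).sum := by
      simp [RTree.fullCuts, coproduct_tree, forest_singleton, forest_zero]
    rw [forest_cons, map_mul, ih, h_tree, RTree.forestCuts_cons]
    simp only [Multiset.map_bind, Multiset.sum_bind, Multiset.map_map, Function.comp_def,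
      Prod.fst_add, Prod.snd_add, forest_add, ← Algebra.TensorProduct.tmul_mul_tmul,
      Multiset.sum_map_mul_left, Multiset.sum_map_mul_right]

theorem coproduct_bPlus (y : H) :
    coproduct (bPlus y) = bPlus y ⊗ₜ[ℝ] (1 : H) + bPlus.lTensor H (coproduct y) := by
  suffices coproduct.toLinearMap ∘ₗ bPlus =
      (TensorProduct.mk ℝ H H).flip 1 ∘ₗ bPlus + bPlus.lTensor H ∘ₗ coproduct.toLinearMap from
    LinearMap.congr_fun this y
  refine linearMap_ext_forest fun F => ?_
  simp [bPlus_forest, coproduct_tree, coproduct_forest, RTree.admissibleCuts_node,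
    map_multiset_sum, Multiset.map_map, Function.comp_def]

end Forest

/-! ### The Hopf algebra structure -/

section TensorProduct

variable {R A B C D : Type*} [CommSemiring R] [CommSemiring A] [Algebra R A] [CommSemiring B]
  [Algebra R B] [CommSemiring C] [Algebra R C] [CommSemiring D] [Algebra R D]

theorem map_id_lTensor_apply (f : A →ₐ[R] B) (L : C →ₗ[R] D) (z : A ⊗[R] C) :
    Algebra.TensorProduct.map f (.id R D) (L.lTensor A z) =
      L.lTensor B (Algebra.TensorProduct.map f (.id R C) z) := by
  induction z using TensorProduct.induction_on with
  | zero => simp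
  | add x y hx hy => simp only [map_add, hx, hy]
  | tmul x y => simp

theorem assoc_tmul_apply (L : C →ₗ[R] D) (w : A ⊗[R] B) (z : C) :
    Algebra.TensorProduct.assoc R R R A B D (w ⊗ₜ L z) =
      (L.lTensor B).lTensor A (Algebra.TensorProduct.assoc R R R A B C (w ⊗ₜ z)) := by
  induction w using TensorProduct.induction_on with
  | zero => simp
  | add w w' hw hw' => simp only [TensorProduct.add_tmul, map_add, hw, hw']
  | tmul x y => simp

end TensorProduct

theorem assoc_map_coproduct_lTensor_bPlus (z : H ⊗[ℝ] H) :
    Algebra.TensorProduct.assoc ℝ ℝ ℝ H H H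
        (Algebra.TensorProduct.map coproduct (.id ℝ H) (bPlus.lTensor H z)) =
      (bPlus.lTensor H).lTensor H (Algebra.TensorProduct.assoc ℝ ℝ ℝ H H H
        (Algebra.TensorProduct.map coproduct (.id ℝ H) z)) := by
  induction z using TensorProduct.induction_on with
  | zero => simp
  | add x y hx hy => simp only [map_add, hx, hy]
  | tmul x y => simp [assoc_tmul_apply]

theorem map_id_coproduct_lTensor_bPlus (z : H ⊗[ℝ] H) :
    Algebra.TensorProduct.map (.id ℝ H) coproduct (bPlus.lTensor H z) =
      Algebra.TensorProduct.assoc ℝ ℝ ℝ H H H (bPlus.lTensor H z ⊗ₜ (1 : H)) +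
        (bPlus.lTensor H).lTensor H (Algebra.TensorProduct.map (.id ℝ H) coproduct z) := by
  induction z using TensorProduct.induction_on with
  | zero => simp
  | add x y hx hy =>
    simp only [map_add, hx, hy, TensorProduct.add_tmul]
    abel
  | tmul x y => simp [coproduct_bPlus, TensorProduct.tmul_add]

theorem coproduct_coassoc :
    ((Algebra.TensorProduct.assoc ℝ ℝ ℝ H H H).toAlgHom.comp
      (Algebra.TensorProduct.map coproduct (.id ℝ H))).comp coproduct =
    (Algebra.TensorProduct.map (.id ℝ H) coproduct).comp coproduct := by
  have h_bPlus (y : H) (ih : Algebra.TensorProduct.assoc ℝ ℝ ℝ H H H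
      (Algebra.TensorProduct.map coproduct (.id ℝ H) (coproduct y)) =
        Algebra.TensorProduct.map (.id ℝ H) coproduct (coproduct y)) :
      Algebra.TensorProduct.assoc ℝ ℝ ℝ H H H
        (Algebra.TensorProduct.map coproduct (.id ℝ H) (coproduct (bPlus y))) =
          Algebra.TensorProduct.map (.id ℝ H) coproduct (coproduct (bPlus y)) := by
    simp only [coproduct_bPlus, map_add, assoc_map_coproduct_lTensor_bPlus,
      map_id_coproduct_lTensor_bPlus, ih, Algebra.TensorProduct.map_tmul, AlgHom.id_apply,
      TensorProduct.add_tmul, Algebra.TensorProduct.assoc_tmul, map_one,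
      Algebra.TensorProduct.one_def]
    abel
  exact algHom_ext_bPlus (C := H ⊗[ℝ] (H ⊗[ℝ] H)) h_bPlus

/-- The counit of `H`, which sends every non-empty tree to `0`. -/
noncomputable def counit : H →ₐ[ℝ] ℝ := MvPolynomial.aeval 0

theorem counit_tree (τ : RTree) : counit (tree τ) = 0 := MvPolynomial.aeval_X _ _

theorem counit_bPlus (y : H) : counit (bPlus y) = 0 := by
  suffices counit.toLinearMap ∘ₗ bPlus = 0 from LinearMap.congr_fun this y
  exact linearMap_ext_forest fun F => by simp [bPlus_forest, counit_tree]

theorem map_id_counit_lTensor_bPlus (z : H ⊗[ℝ] H) :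
    Algebra.TensorProduct.map (.id ℝ H) counit (bPlus.lTensor H z) = 0 := by
  induction z using TensorProduct.induction_on with
  | zero => simp
  | add x y hx hy => simp only [map_add, hx, hy, add_zero]
  | tmul x y => simp [counit_bPlus]

theorem map_counit_id_comp_coproduct :
    (Algebra.TensorProduct.map counit (.id ℝ H)).comp coproduct =
      (Algebra.TensorProduct.lid ℝ H).symm := by
  refine algHom_ext_bPlus fun y ih => ?_
  simp only [AlgHom.comp_apply] at ih ⊢
  rw [coproduct_bPlus, map_add, map_id_lTensor_apply, ih]
  simp [counit_bPlus]

theorem map_id_counit_comp_coproduct :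
    (Algebra.TensorProduct.map (.id ℝ H) counit).comp coproduct =
      (Algebra.TensorProduct.rid ℝ ℝ H).symm := by
  refine algHom_ext_bPlus fun y _ => ?_
  simp only [AlgHom.comp_apply]
  rw [coproduct_bPlus, map_add, map_id_counit_lTensor_bPlus]
  simp

-- Mathlib's bialgebra structure on monoid algebras, under which all forests are group-like, also
-- applies to `H`.  The instances for the structure of this file are therefore scoped.
noncomputable scoped instance : Bialgebra ℝ H :=
  .ofAlgHom coproduct counit coproduct_coassoc map_counit_id_comp_coproduct
    map_id_counit_comp_coproduct

/-- The characters of `H` with values in `C`, with the convolution product of Mathlib's `WithConv`.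
The inverse is given by composition with the antipode. -/
abbrev Character (C : Type*) [CommSemiring C] [Algebra ℝ C] : Type _ := WithConv (H →ₐ[ℝ] C)

theorem one_apply_tree {C : Type*} [CommSemiring C] [Algebra ℝ C] (τ : RTree) :
    (1 : Character C) (tree τ) = 0 := by
  change algebraMap ℝ C (counit (tree τ)) = 0
  rw [counit_tree, map_zero]

theorem comp_one {C D : Type*} [CommSemiring C] [Algebra ℝ C] [CommSemiring D] [Algebra ℝ D]
    (f : C →ₐ[ℝ] D) : f.comp (1 : Character C).ofConv = (1 : Character D).ofConv :=
  MvPolynomial.algHom_ext fun τ =>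
    (congrArg f (one_apply_tree τ)).trans ((map_zero f).trans (one_apply_tree τ).symm)

theorem antipode_tree (τ : RTree) :
    antipode (tree τ) =
      ((RTree.edgeCuts τ).map fun c => (-1 : H) ^ (c.1 + 1) * (tree c.2.1 * forest c.2.2)).sum :=
  MvPolynomial.aeval_X _ _

theorem sum_map_forestEdgeCuts (F : Forest)
    (hF : ∀ t ∈ F, ((RTree.edgeCuts t).map
      fun c => ((-1 : H) ^ c.1 * forest c.2.2) ⊗ₜ[ℝ] tree c.2.1).sum =
        Algebra.TensorProduct.map antipode (.id ℝ H)
          (coproduct (tree t) - tree t ⊗ₜ[ℝ] (1 : H))) :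
    ((RTree.forestEdgeCuts F).map
      fun c => ((-1 : H) ^ c.1 * forest c.2.2) ⊗ₜ[ℝ] forest c.2.1).sum =
        Algebra.TensorProduct.map antipode (.id ℝ H) (coproduct (forest F)) := by
  induction F using Multiset.induction_on with
  | empty => simp [RTree.forestEdgeCuts_zero, forest_zero, Algebra.TensorProduct.one_def]
  | cons t F ih =>
    have h_cut : ((RTree.edgeCuts t).map
        fun c => ((-1 : H) ^ (c.1 + 1) * forest (c.2.1 ::ₘ c.2.2)) ⊗ₜ[ℝ] (1 : H)).sum =
          antipode (tree t) ⊗ₜ[ℝ] (1 : H) := by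
      rw [antipode_tree, ← Algebra.TensorProduct.includeLeft_apply (S := ℝ), map_multiset_sum,
        Multiset.map_map]
      simp only [forest_cons]
      rfl
    have h_planted : ((RTree.plantedEdgeCuts t).map
        fun c => ((-1 : H) ^ c.1 * forest c.2.2) ⊗ₜ[ℝ] forest c.2.1).sum =
          Algebra.TensorProduct.map antipode (.id ℝ H) (coproduct (tree t)) := by
      rw [RTree.plantedEdgeCuts, Multiset.map_add, Multiset.sum_add, Multiset.map_map,
        Multiset.map_map]
      simp only [Function.comp_def, forest_singleton, forest_zero]
      rw [hF t (Multiset.mem_cons_self t F), h_cut, map_sub]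
      simp
    rw [forest_cons, map_mul, map_mul, ← h_planted,
      ← ih fun u hu => hF u (Multiset.mem_cons_of_mem hu), RTree.forestEdgeCuts_cons]
    have h_mul (c d : ℕ × Forest × Forest) :
        ((-1 : H) ^ (c + d).1 * forest (c + d).2.2) ⊗ₜ[ℝ] forest (c + d).2.1 =
          ((-1 : H) ^ c.1 * forest c.2.2) ⊗ₜ[ℝ] forest c.2.1 *
            ((-1 : H) ^ d.1 * forest d.2.2) ⊗ₜ[ℝ] forest d.2.1 := by
      simp only [Prod.fst_add, Prod.snd_add, pow_add, forest_add,
        Algebra.TensorProduct.tmul_mul_tmul, mul_mul_mul_comm]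
    simp only [Multiset.map_bind, Multiset.sum_bind, Multiset.map_map, Function.comp_def, h_mul,
      Multiset.sum_map_mul_left, Multiset.sum_map_mul_right]

theorem sum_map_edgeCuts (τ : RTree) :
    ((RTree.edgeCuts τ).map
      fun c => ((-1 : H) ^ c.1 * forest c.2.2) ⊗ₜ[ℝ] tree c.2.1).sum =
        Algebra.TensorProduct.map antipode (.id ℝ H)
          (coproduct (tree τ) - tree τ ⊗ₜ[ℝ] (1 : H)) := by
  induction τ using RTree.node_induction with
  | h F ih =>
    rw [RTree.edgeCuts_node, ← bPlus_forest, coproduct_bPlus, add_sub_cancel_left,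
      map_id_lTensor_apply, ← sum_map_forestEdgeCuts F ih, map_multiset_sum]
    simp only [Multiset.map_map, Function.comp_def, LinearMap.lTensor_tmul, bPlus_forest]

theorem antipode_convMul_id :
    (WithConv.toConv antipode * WithConv.toConv (AlgHom.id ℝ H) : Character H) = 1 := by
  refine WithConv.ext (MvPolynomial.algHom_ext fun τ => ?_)
  let mul : H ⊗[ℝ] H →ₐ[ℝ] H := Algebra.TensorProduct.lmul' ℝ
  have h_antipode : antipode (tree τ) = -mul (((RTree.edgeCuts τ).map
      fun c => ((-1 : H) ^ c.1 * forest c.2.2) ⊗ₜ[ℝ] tree c.2.1).sum) := by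
    rw [antipode_tree, map_multiset_sum, Multiset.map_map, ← Multiset.sum_map_neg]
    refine congrArg _ (Multiset.map_congr rfl fun c _ => ?_)
    simp only [mul, Function.comp_apply, Algebra.TensorProduct.lmul'_apply_tmul]
    ring
  have h_mul : mul (Algebra.TensorProduct.map antipode (.id ℝ H) (coproduct (tree τ))) = 0 := by
    rw [sum_map_edgeCuts, map_sub, map_sub, Algebra.TensorProduct.map_tmul] at h_antipode
    simpa [mul, sub_eq_self] using h_antipode.symm
  exact h_mul.trans (one_apply_tree τ).symm

theorem id_convMul_antipode :
    (WithConv.toConv (AlgHom.id ℝ H) * WithConv.toConv antipode : Character H) = 1 := by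
  have h_sq : (WithConv.toConv (antipode.comp antipode) * WithConv.toConv antipode :
      Character H) = 1 := by
    have h := congrArg (fun f : Character H => antipode.comp f.ofConv) antipode_convMul_id
    rw [AlgHom.comp_convMul_distrib] at h
    exact WithConv.ext (h.trans (comp_one antipode))
  rwa [left_inv_eq_right_inv h_sq antipode_convMul_id] at h_sq

noncomputable scoped instance : HopfAlgebra ℝ H :=
  .ofAlgHom antipode
    (AlgHom.ext fun x => (AlgHom.convMul_apply _ _ x).symm.trans
      (congrArg (fun f : Character H => f x) antipode_convMul_id))
    (AlgHom.ext fun x => (AlgHom.convMul_apply _ _ x).symm.trans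
      (congrArg (fun f : Character H => f x) id_convMul_antipode))

open WithConv

/-! ### Characters -/

section Character

variable {C : Type*} [CommSemiring C] [Algebra ℝ C]

theorem mul_apply_tree (f g : Character C) (τ : RTree) :
    (f * g) (tree τ) =
      f (tree τ) + ((RTree.admissibleCuts τ).map fun c => f (forest c.1) * g (tree c.2)).sum := by
  refine (AlgHom.convMul_apply f g (tree τ)).trans ?_
  change Algebra.TensorProduct.lift f.ofConv g.ofConv _ (coproduct (tree τ)) = _
  rw [coproduct_tree, map_add, map_multiset_sum, Multiset.map_map]
  simp [Function.comp_def]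

theorem mul_apply_tree_eq_add_sum_properCuts (f g : Character C) (τ : RTree) :
    (f * g) (tree τ) = f (tree τ) + g (tree τ) +
      ((RTree.properCuts τ).map fun c => f (forest c.1) * g (tree c.2)).sum := by
  simp [mul_apply_tree, RTree.admissibleCuts_eq_cons, forest_zero, add_assoc]

theorem conv_eq_ofConv_mul (f g : H →ₐ[ℝ] H) : conv f g = (toConv f * toConv g).ofConv :=
  AlgHom.ext fun x => (AlgHom.convMul_apply (toConv f) (toConv g) x).symm

theorem sqrtId_tree (τ : RTree) : sqrtId (tree τ) = sqrtIdTree τ := MvPolynomial.aeval_X _ _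

theorem sqrtId_mul_sqrtId : (toConv sqrtId * toConv sqrtId : Character H) = toConv (.id ℝ H) := by
  refine WithConv.ext (MvPolynomial.algHom_ext fun τ => ?_)
  refine (mul_apply_tree_eq_add_sum_properCuts _ _ τ).trans ?_
  have h_sqrt : sqrtId (tree τ) = (1 / 2 : ℝ) • (tree τ -
      ((RTree.properCuts τ).map fun c => sqrtId (forest c.1) * sqrtId (tree c.2)).sum) := by
    rw [sqrtId_tree, sqrtIdTree.eq_1, ← Multiset.attach_map_val' (RTree.properCuts τ)
      fun c => sqrtId (forest c.1) * sqrtId (tree c.2)]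
    simp only [map_forest, sqrtId_tree, Multiset.attach_map_val' _ sqrtIdTree]
  change sqrtId (tree τ) + sqrtId (tree τ) +
    ((RTree.properCuts τ).map fun c => sqrtId (forest c.1) * sqrtId (tree c.2)).sum = tree τ
  rw [← two_smul ℝ, h_sqrt, smul_smul]
  norm_num

end Character

section Conj

variable {C : Type*} [CommRing C] [Algebra ℝ C]

theorem involution_tree (τ : RTree) : involution (tree τ) = (-1 : H) ^ RTree.size τ * tree τ :=
  MvPolynomial.aeval_X _ _

theorem involution_forest (F : Forest) :
    involution (forest F) = (-1 : H) ^ (F.map RTree.size).sum * forest F := by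
  induction F using Multiset.induction_on with
  | empty => simp [forest_zero]
  | cons t F ih =>
    rw [forest_cons, map_mul, ih, involution_tree, Multiset.map_cons, Multiset.sum_cons, pow_add]
    ring

theorem involution_comp_involution : involution.comp involution = .id ℝ H :=
  MvPolynomial.algHom_ext fun τ => by
    simp [involution_tree, ← mul_assoc, ← mul_pow]

theorem apply_involution_tree (f : Character C) (τ : RTree) :
    f (involution (tree τ)) = (-1) ^ τ.size * f (tree τ) := by
  simp [involution_tree]

/-- The conjugate `τ ↦ (-1)^|τ| ψ(τ)` of a character `ψ`. -/
noncomputable def conj : Character C →* Character C where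
  toFun ψ := toConv (ψ.ofConv.comp involution)
  map_one' := WithConv.ext <| MvPolynomial.algHom_ext fun τ => by
    change (1 : Character C) (involution (tree τ)) = (1 : Character C) (tree τ)
    rw [involution_tree, map_mul, one_apply_tree, mul_zero]
  map_mul' f g := WithConv.ext <| MvPolynomial.algHom_ext fun τ => by
    change (f * g) (involution (tree τ)) = (toConv (f.ofConv.comp involution) *
      toConv (g.ofConv.comp involution) : Character C) (tree τ)
    rw [involution_tree, map_mul, mul_apply_tree, mul_apply_tree, mul_add,
      ← Multiset.sum_map_mul_left, map_pow, map_neg, map_one]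
    refine congrArg₂ _ (apply_involution_tree f τ).symm
      (congrArg _ (Multiset.map_congr rfl fun c hc => ?_))
    change _ = f (involution (forest c.1)) * g (involution (tree c.2))
    rw [involution_forest, involution_tree, ← RTree.size_of_mem_admissibleCuts τ c hc]
    simp only [map_mul, map_pow, map_neg, map_one, pow_add]
    ring

theorem conj_eq_toConv_comp_involution (f : Character C) :
    conj f = toConv (f.ofConv.comp involution) :=
  rfl

theorem conj_apply_tree (f : Character C) (τ : RTree) :
    conj f (tree τ) = (-1) ^ τ.size * f (tree τ) :=
  apply_involution_tree f τ

theorem conj_conj (f : Character C) : conj (conj f) = f := by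
  rw [conj_eq_toConv_comp_involution, conj_eq_toConv_comp_involution, AlgHom.comp_assoc,
    involution_comp_involution, AlgHom.comp_id]

end Conj

/-! ### Truncation of the group of characters -/

section AgreeUpTo

variable {C : Type*} [CommRing C] [Algebra ℝ C] {n : ℕ}

theorem sum_properCuts_congr {f f' g g' : Character C}
    (hf : ∀ t : RTree, t.size ≤ n → f (tree t) = f' (tree t))
    (hg : ∀ t : RTree, t.size ≤ n → g (tree t) = g' (tree t)) {τ : RTree} (hτ : τ.size ≤ n + 1) :
    ((RTree.properCuts τ).map fun c => f (forest c.1) * g (tree c.2)).sum =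
      ((RTree.properCuts τ).map fun c => f' (forest c.1) * g' (tree c.2)).sum := by
  refine congrArg _ (Multiset.map_congr rfl fun c hc => ?_)
  have h_trunk := RTree.size_trunk_lt hc
  have h_pruned : f (forest c.1) = f' (forest c.1) := by
    rw [map_forest, map_forest]
    refine congrArg _ (Multiset.map_congr rfl fun t ht => hf t ?_)
    have := RTree.size_pruned_lt hc ht
    lia
  rw [h_pruned, hg c.2 (by lia)]

/-- Equality of two characters on all trees with at most `n` vertices.  The quotient of the group of
characters by this congruence is the truncated Butcher group. -/
def agreeUpTo (C : Type*) [CommRing C] [Algebra ℝ C] (n : ℕ) : Con (Character C) where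
  r f g := ∀ τ : RTree, τ.size ≤ n → f (tree τ) = g (tree τ)
  iseqv := ⟨fun _ _ _ => rfl, fun h τ hτ => (h τ hτ).symm, fun h k τ hτ => (h τ hτ).trans (k τ hτ)⟩
  mul' hf hg τ hτ := by
    rw [mul_apply_tree_eq_add_sum_properCuts, mul_apply_tree_eq_add_sum_properCuts, hf τ hτ,
      hg τ hτ, sum_properCuts_congr hf hg (hτ.trans n.le_succ)]

theorem mul_apply_tree_of_agreeUpTo_one_left {f : Character C} (g : Character C)
    (hf : agreeUpTo C n f 1) {τ : RTree} (hτ : τ.size ≤ n + 1) :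
    (f * g) (tree τ) = f (tree τ) + g (tree τ) := by
  have h_one := mul_apply_tree_eq_add_sum_properCuts 1 g τ
  rw [one_mul, one_apply_tree] at h_one
  rw [mul_apply_tree_eq_add_sum_properCuts, sum_properCuts_congr hf (fun _ _ => rfl) hτ]
  linear_combination -h_one

theorem mul_apply_tree_of_agreeUpTo_one_right (f : Character C) {g : Character C}
    (hg : agreeUpTo C n g 1) {τ : RTree} (hτ : τ.size ≤ n + 1) :
    (f * g) (tree τ) = f (tree τ) + g (tree τ) := by
  have h_one := mul_apply_tree_eq_add_sum_properCuts f 1 τ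
  rw [mul_one, one_apply_tree] at h_one
  rw [mul_apply_tree_eq_add_sum_properCuts, sum_properCuts_congr (fun _ _ => rfl) hg hτ]
  linear_combination -h_one

theorem agreeUpTo_of_mul_self {f g : Character C} (h : agreeUpTo C n (f * f) (g * g)) :
    agreeUpTo C n f g := by
  have h_le (m : ℕ) (hm : m ≤ n) : agreeUpTo C m f g := by
    induction m with
    | zero => exact fun τ hτ => absurd τ.size_pos (by lia)
    | succ m ih =>
      intro τ hτ
      have h_sq := h τ (hτ.trans hm)
      rw [mul_apply_tree_eq_add_sum_properCuts, mul_apply_tree_eq_add_sum_properCuts,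
        sum_properCuts_congr (ih (by lia)) (ih (by lia)) hτ] at h_sq
      have h_two : (2 : ℝ) • f (tree τ) = (2 : ℝ) • g (tree τ) := by
        rw [two_smul, two_smul]
        exact add_right_cancel h_sq
      exact smul_right_injective C two_ne_zero h_two
  exact h_le n le_rfl

end AgreeUpTo

/-! ### The symmetry defect -/

section SymmetryDefect

variable {C : Type*} [CommRing C] [Algebra ℝ C]

/-- The defect of symmetry `ψ * ψ̄` of a character `ψ`, where `ψ̄` is the conjugate: a one-step
method is symmetric when this is the unit. -/
noncomputable def symmetryDefect (ψ : Character C) : Character C := ψ * conj ψ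

theorem agreeUpTo_symmetryDefect_one_succ {n : ℕ} (hn : Even n) {ψ : Character C}
    (h : agreeUpTo C n (symmetryDefect ψ) 1) : agreeUpTo C (n + 1) (symmetryDefect ψ) 1 := by
  have h_comm : symmetryDefect ψ * ψ = ψ * conj (symmetryDefect ψ) := by
    simp only [symmetryDefect, map_mul, conj_conj, mul_assoc]
  have h_conj : agreeUpTo C n (conj (symmetryDefect ψ)) 1 := fun τ hτ => by
    rw [conj_apply_tree, h τ hτ, one_apply_tree, mul_zero]
  intro τ hτ
  rcases hτ.lt_or_eq with hlt | heq
  · exact h τ (by lia)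
  have h_tree := congrArg (fun f : Character C => f (tree τ)) h_comm
  simp only [mul_apply_tree_of_agreeUpTo_one_left ψ h hτ, conj_apply_tree, heq,
    mul_apply_tree_of_agreeUpTo_one_right ψ h_conj hτ, hn.add_one.neg_one_pow] at h_tree
  have h_two : (2 : ℝ) • symmetryDefect ψ (tree τ) = (2 : ℝ) • 0 := by
    rw [two_smul, smul_zero]
    linear_combination h_tree
  rw [one_apply_tree]
  exact smul_right_injective C two_ne_zero h_two

end SymmetryDefect

section SymmetricPart

/-- The character `τ ↦ ψ(τ⁻)`. -/
noncomputable def antisymmetricPart (ψ : Character ℝ) : Character ℝ := toConv (ψ.ofConv.comp minus)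

/-- The character `τ ↦ ψ(τ⁺)`. -/
noncomputable def symmetricPart (ψ : Character ℝ) : Character ℝ := toConv (ψ.ofConv.comp plus)

theorem toConv_comp_conv (ψ : Character ℝ) (f g : H →ₐ[ℝ] H) :
    (toConv (ψ.ofConv.comp (conv f g)) : Character ℝ) =
      toConv (ψ.ofConv.comp f) * toConv (ψ.ofConv.comp g) := by
  rw [conv_eq_ofConv_mul]
  exact congrArg toConv (AlgHom.comp_convMul_distrib _ _ _)

theorem inv_eq_toConv_comp_antipode (ψ : Character ℝ) :
    ψ⁻¹ = toConv (ψ.ofConv.comp antipode) :=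
  rfl

theorem symmetricPart_eq (ψ : Character ℝ) : symmetricPart ψ = ψ * (antisymmetricPart ψ)⁻¹ := by
  rw [symmetricPart, plus, toConv_comp_conv, AlgHom.comp_id, toConv_ofConv,
    inv_eq_toConv_comp_antipode, antisymmetricPart, AlgHom.comp_assoc]

theorem toConv_comp_sqrtId_mul_self (ψ : Character ℝ) :
    (toConv (ψ.ofConv.comp sqrtId) * toConv (ψ.ofConv.comp sqrtId) : Character ℝ) = ψ := by
  have h_conv : conv sqrtId sqrtId = .id ℝ H :=
    (conv_eq_ofConv_mul _ _).trans (congrArg ofConv sqrtId_mul_sqrtId)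
  rw [← toConv_comp_conv, h_conv, AlgHom.comp_id]

theorem toConv_comp_antipode_comp_involution (ψ : Character ℝ) :
    (toConv (ψ.ofConv.comp (antipode.comp involution)) : Character ℝ) = (conj ψ)⁻¹ := by
  rw [← map_inv, inv_eq_toConv_comp_antipode, conj_eq_toConv_comp_involution, AlgHom.comp_assoc]

theorem antisymmetricPart_mul_self (ψ : Character ℝ) :
    antisymmetricPart ψ * antisymmetricPart ψ = (conj ψ)⁻¹ * ψ := by
  have h_conv := toConv_comp_conv ψ (antipode.comp involution) (.id ℝ H)
  rw [toConv_comp_antipode_comp_involution, AlgHom.comp_id, toConv_ofConv] at h_conv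
  have h_eq : antisymmetricPart ψ = toConv (((conj ψ)⁻¹ * ψ).ofConv.comp sqrtId) := by
    rw [← h_conv, ofConv_toConv, antisymmetricPart, minus, AlgHom.comp_assoc]
  rw [h_eq, toConv_comp_sqrtId_mul_self]

theorem agreeUpTo_mul_right_iff {n : ℕ} {f g : Character ℝ} (k : Character ℝ) :
    agreeUpTo ℝ n (f * k) (g * k) ↔ agreeUpTo ℝ n f g := by
  refine ⟨fun h => ?_, fun h => (agreeUpTo ℝ n).mul h ((agreeUpTo ℝ n).refl k)⟩
  have h_inv := (agreeUpTo ℝ n).mul h ((agreeUpTo ℝ n).refl k⁻¹)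
  rwa [mul_inv_cancel_right, mul_inv_cancel_right] at h_inv

theorem agreeUpTo_symmetricPart_one_iff {n : ℕ} {ψ : Character ℝ} :
    agreeUpTo ℝ n (symmetricPart ψ) 1 ↔ agreeUpTo ℝ n (symmetryDefect ψ) 1 := by
  calc agreeUpTo ℝ n (symmetricPart ψ) 1
    _ ↔ agreeUpTo ℝ n ψ (antisymmetricPart ψ) := by
      rw [← agreeUpTo_mul_right_iff (antisymmetricPart ψ), symmetricPart_eq,
        inv_mul_cancel_right, one_mul]
    _ ↔ agreeUpTo ℝ n (ψ * ψ) (antisymmetricPart ψ * antisymmetricPart ψ) :=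
      ⟨fun h => (agreeUpTo ℝ n).mul h h, agreeUpTo_of_mul_self⟩
    _ ↔ agreeUpTo ℝ n ψ (conj ψ)⁻¹ := by
      rw [antisymmetricPart_mul_self, agreeUpTo_mul_right_iff]
    _ ↔ agreeUpTo ℝ n (symmetryDefect ψ) 1 := by
      rw [← agreeUpTo_mul_right_iff (conj ψ), inv_mul_cancel, symmetryDefect]

end SymmetricPart

theorem natCast_le_sSup_iff {p : ℕ → Prop} (h0 : p 0) (hp : Antitone p) {k : ℕ} :
    (k : ℕ∞) ≤ sSup {N : ℕ∞ | ∃ n : ℕ, N = n ∧ p n} ↔ p k := by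
  refine ⟨fun h => ?_, fun h => le_sSup ⟨k, rfl, h⟩⟩
  cases k with
  | zero => exact h0
  | succ k =>
    have h_lt : (k : ℕ∞) < sSup {N : ℕ∞ | ∃ n : ℕ, N = n ∧ p n} :=
      lt_of_lt_of_le (Nat.cast_lt.2 k.lt_succ_self) h
    obtain ⟨_, ⟨n, rfl, hn⟩, hkn⟩ := lt_sSup_iff.1 h_lt
    exact hp (Nat.cast_lt.1 hkn) hn

theorem eq_natCast_iff_le_and_lt {x : ℕ∞} {k : ℕ} : x = k ↔ k ≤ x ∧ x < (k + 1 : ℕ) := by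
  rw [Nat.cast_add_one, ENat.lt_add_one_iff (ENat.natCast_ne_top k), le_antisymm_iff, and_comm]

theorem natCast_le_order_iff {ψ : H →ₐ[ℝ] ℝ} {k : ℕ} :
    (k : ℕ∞) ≤ order ψ ↔
      ∀ τ : RTree, τ.size ≤ k → ψ (tree τ) = 1 / (τ.factorial : ℝ) :=
  natCast_le_sSup_iff
    (p := fun n => ∀ τ : RTree, τ.size ≤ n → ψ (tree τ) = 1 / (τ.factorial : ℝ))
    (fun τ hτ => absurd hτ τ.size_pos.not_ge) fun _ _ hmn h τ hτ => h τ (hτ.trans hmn)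

theorem natCast_le_antisymmetricOrder_iff {ψ : H →ₐ[ℝ] ℝ} {k : ℕ} :
    (k : ℕ∞) ≤ antisymmetricOrder ψ ↔ agreeUpTo ℝ k (symmetryDefect (toConv ψ)) 1 := by
  rw [← agreeUpTo_symmetricPart_one_iff]
  refine (natCast_le_sSup_iff (p := fun n => ∀ τ : RTree, τ.size ≤ n → ψ (plus (tree τ)) = 0)
    (fun τ hτ => absurd hτ τ.size_pos.not_ge) fun _ _ hmn h τ hτ => h τ (hτ.trans hmn)).trans ?_
  refine forall₂_congr fun τ _ => ?_
  rw [one_apply_tree]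
  rfl

/-! ### Ladders and corollas -/

namespace RTree

/-- The path on `n + 1` vertices, rooted at an end. -/
def ladder (n : ℕ) : RTree := (fun τ => node {τ})^[n] (node 0)

/-- The tree all of whose `n` non-root vertices are children of the root. -/
def corolla (n : ℕ) : RTree := node (Multiset.replicate n (node 0))

theorem ladder_zero : ladder 0 = node 0 := rfl

theorem ladder_succ (n : ℕ) : ladder (n + 1) = node {ladder n} :=
  Function.iterate_succ_apply' _ n _

theorem corolla_zero : corolla 0 = node 0 := rfl

theorem corolla_one : corolla 1 = ladder 1 := rfl

theorem size_ladder (n : ℕ) : (ladder n).size = n + 1 := by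
  induction n with
  | zero => simp [ladder_zero, size_node]
  | succ n ih => simp [ladder_succ, size_node, ih]

theorem size_corolla (n : ℕ) : (corolla n).size = n + 1 := by simp [corolla, size_node]

end RTree

/-- The powers of the grafting operator applied to the empty tree, that is the paths, starting with
the empty one. -/
noncomputable def ladder (n : ℕ) : H := bPlus^[n] 1

theorem ladder_zero : ladder 0 = 1 := rfl

theorem ladder_succ (n : ℕ) : ladder (n + 1) = bPlus (ladder n) :=
  Function.iterate_succ_apply' _ n _

theorem ladder_succ_eq_tree (n : ℕ) : ladder (n + 1) = tree (RTree.ladder n) := by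
  induction n with
  | zero => rw [ladder_succ, ladder_zero, ← forest_zero, bPlus_forest,
      RTree.ladder_zero]
  | succ n ih => rw [ladder_succ, ih, ← forest_singleton, bPlus_forest, RTree.ladder_succ]

theorem coproduct_ladder (n : ℕ) :
    coproduct (ladder n) =
      ∑ p ∈ Finset.HasAntidiagonal.antidiagonal n, ladder p.1 ⊗ₜ[ℝ] ladder p.2 := by
  induction n with
  | zero => simp [ladder_zero, Algebra.TensorProduct.one_def]
  | succ n ih =>
    rw [Finset.Nat.sum_antidiagonal_succ', ladder_succ, coproduct_bPlus, ih, map_sum]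
    simp [ladder_succ, ladder_zero]

theorem bPlus_one : bPlus 1 = tree (.node 0) := by rw [← forest_zero, bPlus_forest]

theorem bPlus_tree (τ : RTree) : bPlus (tree τ) = tree (.node {τ}) := by
  rw [← forest_singleton, bPlus_forest]

theorem bPlus_pow (τ : RTree) (n : ℕ) :
    bPlus (tree τ ^ n) = tree (.node (Multiset.replicate n τ)) := by
  rw [← bPlus_forest, forest, Multiset.map_replicate, Multiset.prod_replicate]

theorem bPlus_mul (τ τ' : RTree) : bPlus (tree τ * tree τ') = tree (.node {τ, τ'}) := by
  rw [← bPlus_forest]; simp [forest]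

theorem coproduct_dot :
    coproduct (tree (.node 0)) =
      tree (.node 0) ⊗ₜ[ℝ] (1 : H) + (1 : H) ⊗ₜ[ℝ] tree (.node 0) := by
  rw [← bPlus_one, coproduct_bPlus, map_one coproduct, Algebra.TensorProduct.one_def,
    LinearMap.lTensor_tmul]

theorem coproduct_corolla (n : ℕ) :
    coproduct (tree (.corolla n)) = tree (.corolla n) ⊗ₜ[ℝ] (1 : H) +
      ∑ k ∈ Finset.range (n + 1),
        n.choose k • (tree (.node 0) ^ (n - k)) ⊗ₜ[ℝ] tree (.corolla k) := by
  simp only [RTree.corolla, ← bPlus_pow, coproduct_bPlus, map_pow, coproduct_dot]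
  rw [add_comm (tree (.node 0) ⊗ₜ[ℝ] (1 : H)), add_pow, map_sum]
  simp [← nsmul_eq_mul', -nsmul_eq_mul]

theorem coproduct_corolla_two :
    coproduct (tree (.corolla 2)) = tree (.corolla 2) ⊗ₜ[ℝ] (1 : H) +
      (tree (.node 0) ^ 2) ⊗ₜ[ℝ] tree (.node 0) + 2 • tree (.node 0) ⊗ₜ[ℝ] tree (.ladder 1) +
        (1 : H) ⊗ₜ[ℝ] tree (.corolla 2) := by
  simp [coproduct_corolla, Finset.sum_range_succ, add_assoc, RTree.corolla_zero, RTree.corolla_one]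

theorem coproduct_ladder_one :
    coproduct (tree (.ladder 1)) = tree (.ladder 1) ⊗ₜ[ℝ] (1 : H) +
      tree (.node 0) ⊗ₜ[ℝ] tree (.node 0) + (1 : H) ⊗ₜ[ℝ] tree (.ladder 1) := by
  rw [← RTree.corolla_one, coproduct_corolla]
  simp [Finset.sum_range_succ, add_assoc, RTree.corolla_zero]

section Product

variable {C : Type*} [CommSemiring C] [Algebra ℝ C] (f g : Character C)

theorem mul_apply (x : H) :
    (f * g) x = Algebra.TensorProduct.productMap f.ofConv g.ofConv (coproduct x) :=
  AlgHom.convMul_apply f g x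

theorem mul_apply_ladder (n : ℕ) :
    (f * g) (ladder n) =
      ∑ p ∈ Finset.HasAntidiagonal.antidiagonal n, f (ladder p.1) * g (ladder p.2) := by
  simp [mul_apply, coproduct_ladder]

theorem mul_apply_corolla (n : ℕ) :
    (f * g) (tree (.corolla n)) = f (tree (.corolla n)) +
      ∑ k ∈ Finset.range (n + 1),
        n.choose k * (f (tree (.node 0)) ^ (n - k) * g (tree (.corolla k))) := by
  simp [mul_apply, coproduct_corolla]

theorem mul_apply_node_corolla_two :
    (f * g) (tree (.node {.corolla 2})) =
      f (tree (.node {.corolla 2})) + f (tree (.corolla 2)) * g (tree (.node 0)) +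
        f (tree (.node 0)) ^ 2 * g (tree (.ladder 1)) +
          2 * (f (tree (.node 0)) * g (tree (.ladder 2))) + g (tree (.node {.corolla 2})) := by
  have h_ladder : (.node {.node 0} : RTree) = .ladder 1 := rfl
  rw [mul_apply, ← bPlus_tree, coproduct_bPlus, coproduct_corolla_two]
  simp [bPlus_tree, bPlus_one, ← RTree.ladder_succ, h_ladder, add_assoc, two_nsmul, two_mul,
    -nsmul_eq_mul]

theorem mul_apply_node_dot_ladder_one :
    (f * g) (tree (.node {.node 0, .ladder 1})) =
      f (tree (.node {.node 0, .ladder 1})) +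
        f (tree (.node 0)) * f (tree (.ladder 1)) * g (tree (.node 0)) +
          (f (tree (.node 0)) ^ 2 + f (tree (.ladder 1))) * g (tree (.ladder 1)) +
            f (tree (.node 0)) * (g (tree (.ladder 2)) + g (tree (.corolla 2))) +
              g (tree (.node {.node 0, .ladder 1})) := by
  have h_one : (.node {.node 0} : RTree) = .ladder 1 := rfl
  have h_two : (.node {.ladder 1} : RTree) = .ladder 2 := rfl
  have h_corolla : (.node {.node 0, .node 0} : RTree) = .corolla 2 := rfl
  rw [mul_apply, ← bPlus_mul, coproduct_bPlus, map_mul coproduct, coproduct_dot,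
    coproduct_ladder_one]
  simp only [add_mul, mul_add, Algebra.TensorProduct.tmul_mul_tmul, one_mul, mul_one, map_add,
    map_mul, map_one, LinearMap.lTensor_tmul, bPlus_one, bPlus_tree, bPlus_mul, h_one, h_two,
    h_corolla, Algebra.TensorProduct.productMap_apply_tmul]
  ring

end Product

/-! ### The symmetry defect on small trees -/

section SymmetryDefect

variable {ψ : Character ℝ}

theorem conj_apply_ladder (n : ℕ) : conj ψ (ladder n) = (-1) ^ n * ψ (ladder n) := by
  cases n with
  | zero =>
    rw [ladder_zero, map_one, map_one, pow_zero, one_mul]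
  | succ n => rw [ladder_succ_eq_tree, conj_apply_tree, RTree.size_ladder]

theorem symmetryDefect_ladder_two_mul {n : ℕ} (h : ∀ k, n < k → ψ (ladder k) = 0) :
    symmetryDefect ψ (ladder (2 * n)) = (-1) ^ n * ψ (ladder n) ^ 2 := by
  rw [symmetryDefect, mul_apply_ladder, Finset.sum_eq_single (n, n), conj_apply_ladder]
  · ring
  · rintro ⟨p, q⟩ hpq hne
    rw [Finset.HasAntidiagonal.mem_antidiagonal] at hpq
    obtain hp | hq : n < p ∨ n < q := by grind
    · rw [h p hp, zero_mul]
    · rw [conj_apply_ladder, h q hq, mul_zero, mul_zero]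
  · intro hn
    exact absurd (Finset.HasAntidiagonal.mem_antidiagonal.2 (two_mul n).symm) hn

theorem symmetryDefect_ladder_one :
    symmetryDefect ψ (tree (.ladder 1)) = 2 * ψ (tree (.ladder 1)) - ψ (tree (.node 0)) ^ 2 := by
  rw [symmetryDefect, ← RTree.corolla_one, mul_apply_corolla]
  simp only [Finset.sum_range_succ, Finset.sum_range_zero, conj_apply_tree, RTree.size_corolla,
    RTree.corolla_zero, Nat.choose_zero_right, Nat.choose_self]
  ring

variable (h_dot : ψ (tree (.node 0)) = 1) (h_one : ψ (tree (.ladder 1)) = 1 / 2)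
include h_dot h_one

theorem symmetryDefect_ladder_three :
    symmetryDefect ψ (tree (.ladder 3)) =
      2 * ψ (tree (.ladder 3)) - 2 * ψ (tree (.ladder 2)) + 1 / 4 := by
  rw [symmetryDefect, ← ladder_succ_eq_tree, mul_apply_ladder,
    Finset.Nat.sum_antidiagonal_eq_sum_range_succ_mk]
  simp only [Finset.sum_range_succ, Finset.sum_range_zero, conj_apply_ladder, ladder_zero, map_one,
    ladder_succ_eq_tree, RTree.ladder_zero, h_dot, h_one, tsub_zero, tsub_self]
  ring

theorem symmetryDefect_node_corolla_two :
    symmetryDefect ψ (tree (.node {.corolla 2})) =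
      2 * ψ (tree (.node {.corolla 2})) - ψ (tree (.corolla 2)) - 2 * ψ (tree (.ladder 2)) +
        1 / 2 := by
  rw [symmetryDefect, mul_apply_node_corolla_two]
  simp only [conj_apply_tree, RTree.size_node, RTree.size_corolla, RTree.size_ladder, h_dot, h_one,
    Multiset.map_singleton, Multiset.map_zero, Multiset.sum_singleton, Multiset.sum_zero]
  ring

theorem symmetryDefect_node_dot_ladder_one :
    symmetryDefect ψ (tree (.node {.node 0, .ladder 1})) =
      2 * ψ (tree (.node {.node 0, .ladder 1})) - ψ (tree (.corolla 2)) - ψ (tree (.ladder 2)) +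
        1 / 4 := by
  rw [symmetryDefect, mul_apply_node_dot_ladder_one]
  simp only [conj_apply_tree, RTree.size_node, RTree.size_corolla, RTree.size_ladder, h_dot, h_one,
    Multiset.insert_eq_cons, Multiset.map_cons, Multiset.map_singleton, Multiset.map_zero,
    Multiset.sum_cons, Multiset.sum_singleton, Multiset.sum_zero]
  ring

theorem symmetryDefect_corolla_three :
    symmetryDefect ψ (tree (.corolla 3)) =
      2 * ψ (tree (.corolla 3)) - 3 * ψ (tree (.corolla 2)) + 1 / 2 := by
  rw [symmetryDefect, mul_apply_corolla]
  simp only [Finset.sum_range_succ, Finset.sum_range_zero, conj_apply_tree, RTree.size_corolla,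
    RTree.corolla_zero, zero_add, RTree.corolla_one, h_dot, h_one, Nat.choose_zero_right,
    Nat.choose_one_right, Nat.choose_self, Nat.choose_succ_self_right]
  ring

end SymmetryDefect

/-! ### Trees with at most four vertices -/

namespace RTree

theorem eq_zero_of_sum_size_eq_zero {F : Forest} (h : (F.map size).sum = 0) : F = 0 :=
  Multiset.eq_zero_of_forall_notMem fun t ht =>
    t.size_pos.ne' (Multiset.sum_eq_zero_iff.1 h _ (Multiset.mem_map_of_mem size ht))

theorem exists_eq_cons_of_sum_size_ne_zero {F : Forest} (h : (F.map size).sum ≠ 0) :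
    ∃ t G, F = t ::ₘ G ∧ size t + (G.map size).sum = (F.map size).sum := by
  obtain ⟨t, ht⟩ := Multiset.exists_mem_of_ne_zero (s := F) (by rintro rfl; simp at h)
  obtain ⟨G, rfl⟩ := Multiset.exists_cons_of_mem ht
  exact ⟨t, G, rfl, by simp⟩

theorem size_eq_one_iff {τ : RTree} : τ.size = 1 ↔ τ = node 0 := by
  refine ⟨fun h => ?_, fun h => by rw [h, size_node]; simp⟩
  obtain ⟨F, rfl⟩ := exists_eq_node τ
  rw [size_node] at h
  rw [eq_zero_of_sum_size_eq_zero (F := F) (by lia)]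

theorem eq_singleton_dot_of_sum_size_eq_one {F : Forest} (h : (F.map size).sum = 1) :
    F = {node 0} := by
  obtain ⟨t, G, rfl, hs⟩ := exists_eq_cons_of_sum_size_ne_zero (F := F) (by lia)
  have := t.size_pos
  rw [size_eq_one_iff.1 (by lia : t.size = 1), eq_zero_of_sum_size_eq_zero (F := G) (by lia)]
  rfl

theorem size_eq_two_iff {τ : RTree} : τ.size = 2 ↔ τ = ladder 1 := by
  refine ⟨fun h => ?_, fun h => by rw [h, size_ladder]⟩
  obtain ⟨F, rfl⟩ := exists_eq_node τ
  rw [size_node] at h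
  rw [eq_singleton_dot_of_sum_size_eq_one (F := F) (by lia)]
  rfl

theorem eq_of_sum_size_eq_two {F : Forest} (h : (F.map size).sum = 2) :
    F = {ladder 1} ∨ F = {node 0, node 0} := by
  obtain ⟨t, G, rfl, hs⟩ := exists_eq_cons_of_sum_size_ne_zero (F := F) (by lia)
  have := t.size_pos
  obtain ht | ht : t.size = 1 ∨ t.size = 2 := by lia
  · rw [size_eq_one_iff.1 ht, eq_singleton_dot_of_sum_size_eq_one (F := G) (by lia)]
    exact .inr rfl
  · rw [size_eq_two_iff.1 ht, eq_zero_of_sum_size_eq_zero (F := G) (by lia)]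
    exact .inl rfl

theorem size_eq_three_iff {τ : RTree} : τ.size = 3 ↔ τ = ladder 2 ∨ τ = corolla 2 := by
  constructor
  · intro h
    obtain ⟨F, rfl⟩ := exists_eq_node τ
    rw [size_node] at h
    rcases eq_of_sum_size_eq_two (F := F) (by lia) with rfl | rfl
    · exact .inl rfl
    · exact .inr rfl
  · rintro (rfl | rfl)
    · rw [size_ladder]
    · rw [size_corolla]

theorem eq_of_sum_size_eq_three {F : Forest} (h : (F.map size).sum = 3) :
    F = {ladder 2} ∨ F = {corolla 2} ∨ F = {node 0, ladder 1} ∨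
      F = {node 0, node 0, node 0} := by
  obtain ⟨t, G, rfl, hs⟩ := exists_eq_cons_of_sum_size_ne_zero (F := F) (by lia)
  have := t.size_pos
  obtain ht | ht | ht : t.size = 1 ∨ t.size = 2 ∨ t.size = 3 := by lia
  · rw [size_eq_one_iff.1 ht]
    rcases eq_of_sum_size_eq_two (F := G) (by lia) with rfl | rfl
    · exact .inr (.inr (.inl rfl))
    · exact .inr (.inr (.inr rfl))
  · rw [size_eq_two_iff.1 ht, eq_singleton_dot_of_sum_size_eq_one (F := G) (by lia)]
    exact .inr (.inr (.inl (Multiset.cons_swap _ _ _)))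
  · rw [eq_zero_of_sum_size_eq_zero (F := G) (by lia)]
    rcases size_eq_three_iff.1 ht with rfl | rfl
    · exact .inl rfl
    · exact .inr (.inl rfl)

theorem size_eq_four_iff {τ : RTree} :
    τ.size = 4 ↔
      τ = ladder 3 ∨ τ = node {corolla 2} ∨ τ = node {node 0, ladder 1} ∨ τ = corolla 3 := by
  constructor
  · intro h
    obtain ⟨F, rfl⟩ := exists_eq_node τ
    rw [size_node] at h
    rcases eq_of_sum_size_eq_three (F := F) (by lia) with rfl | rfl | rfl | rfl
    · exact .inl rfl
    · exact .inr (.inl rfl)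
    · exact .inr (.inr (.inl rfl))
    · exact .inr (.inr (.inr rfl))
  · rintro (rfl | rfl | rfl | rfl) <;> simp [size_node, size_ladder, size_corolla]

theorem factorial_node (F : Forest) :
    factorial (node F) = size (node F) * (F.map factorial).prod := by
  rw [factorial, para_node]
  simp [Multiset.map_map]

theorem factorial_ladder (n : ℕ) : factorial (ladder n) = (n + 1).factorial := by
  induction n with
  | zero => simp [ladder_zero, factorial_node, size_node]
  | succ n ih =>
    rw [ladder_succ, factorial_node, ← ladder_succ, size_ladder, Multiset.map_singleton,
      Multiset.prod_singleton, ih, Nat.factorial_succ (n + 1)]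

end RTree

theorem agreeUpTo_succ_iff {C : Type*} [CommRing C] [Algebra ℝ C] {f g : Character C} {n : ℕ} :
    agreeUpTo C (n + 1) f g ↔
      agreeUpTo C n f g ∧ ∀ τ : RTree, τ.size = n + 1 → f (tree τ) = g (tree τ) := by
  refine ⟨fun h => ⟨fun τ hτ => h τ (hτ.trans n.le_succ), fun τ hτ => h τ hτ.le⟩, fun h τ hτ => ?_⟩
  exact (Nat.le_succ_iff.1 hτ).elim (h.1 τ) (h.2 τ)

theorem two_le_order_iff {ψ : H →ₐ[ℝ] ℝ} :
    2 ≤ order ψ ↔ ψ (tree (.node 0)) = 1 ∧ ψ (tree (.ladder 1)) = 1 / 2 := by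
  have h_one : (RTree.node 0).factorial = 1 := RTree.factorial_ladder 0
  refine (natCast_le_order_iff (k := 2)).trans ⟨fun h => ⟨?_, ?_⟩, fun h τ hτ => ?_⟩
  · simpa [h_one] using h (.node 0) (by simp [RTree.size_node])
  · simpa [RTree.factorial_ladder] using h (.ladder 1) (RTree.size_ladder 1).le
  · have := τ.size_pos
    obtain hs | hs : τ.size = 1 ∨ τ.size = 2 := by lia
    · simp [RTree.size_eq_one_iff.1 hs, h_one, h.1]
    · simp [RTree.size_eq_two_iff.1 hs, RTree.factorial_ladder, h.2]

theorem order_lt_three {ψ : H →ₐ[ℝ] ℝ} (h : ψ (tree (.ladder 2)) ≠ 1 / 6) : order ψ < 3 := by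
  refine lt_of_not_ge fun h_le => h ?_
  rw [(natCast_le_order_iff (k := 3)).1 h_le (.ladder 2) (RTree.size_ladder 2).le,
    RTree.factorial_ladder]
  norm_num [Nat.factorial]

theorem agreeUpTo_three_symmetryDefect_one {ψ : Character ℝ} (h_dot : ψ (tree (.node 0)) = 1)
    (h_one : ψ (tree (.ladder 1)) = 1 / 2) : agreeUpTo ℝ 3 (symmetryDefect ψ) 1 := by
  refine agreeUpTo_symmetryDefect_one_succ (by decide) (agreeUpTo_succ_iff.2 ⟨?_, fun τ hτ => ?_⟩)
  · exact agreeUpTo_symmetryDefect_one_succ (by decide) fun τ hτ => absurd hτ τ.size_pos.not_ge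
  · rw [RTree.size_eq_two_iff.1 hτ, symmetryDefect_ladder_one, one_apply_tree, h_dot, h_one]
    norm_num

theorem agreeUpTo_five_symmetryDefect_one_iff {ψ : Character ℝ}
    (h : agreeUpTo ℝ 3 (symmetryDefect ψ) 1) :
    agreeUpTo ℝ 5 (symmetryDefect ψ) 1 ↔
      ∀ τ : RTree, τ.size = 4 → symmetryDefect ψ (tree τ) = 0 := by
  refine ⟨fun h_five τ hτ => (h_five τ (by lia)).trans (one_apply_tree τ), fun h_four => ?_⟩
  exact agreeUpTo_symmetryDefect_one_succ (by decide)
    (agreeUpTo_succ_iff.2 ⟨h, fun τ hτ => (h_four τ hτ).trans (one_apply_tree τ).symm⟩)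

theorem five_le_antisymmetricOrder_iff {ψ : H →ₐ[ℝ] ℝ} (h_dot : ψ (tree (.node 0)) = 1)
    (h_one : ψ (tree (.ladder 1)) = 1 / 2) :
    5 ≤ antisymmetricOrder ψ ↔
      2 * ψ (tree (.ladder 3)) - 2 * ψ (tree (.ladder 2)) + 1 / 4 = 0 ∧
      2 * ψ (tree (.node {.corolla 2})) - ψ (tree (.corolla 2)) - 2 * ψ (tree (.ladder 2)) +
        1 / 2 = 0 ∧
      2 * ψ (tree (.node {.node 0, .ladder 1})) - ψ (tree (.corolla 2)) - ψ (tree (.ladder 2)) +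
        1 / 4 = 0 ∧
      2 * ψ (tree (.corolla 3)) - 3 * ψ (tree (.corolla 2)) + 1 / 2 = 0 := by
  refine (natCast_le_antisymmetricOrder_iff (k := 5)).trans ?_
  rw [agreeUpTo_five_symmetryDefect_one_iff (agreeUpTo_three_symmetryDefect_one h_dot h_one)]
  simp only [RTree.size_eq_four_iff, forall_eq_or_imp, forall_eq]
  rw [symmetryDefect_ladder_three h_dot h_one, symmetryDefect_node_corolla_two h_dot h_one,
    symmetryDefect_node_dot_ladder_one h_dot h_one, symmetryDefect_corolla_three h_dot h_one]

theorem antisymmetricOrder_lt_two_mul {ψ : H →ₐ[ℝ] ℝ} {n : ℕ} (hn : n ≠ 0)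
    (h_ne : ψ (ladder n) ≠ 0) (h_zero : ∀ k, n < k → ψ (ladder k) = 0) :
    antisymmetricOrder ψ < (2 * n : ℕ) := by
  refine lt_of_not_ge fun h_le => ?_
  obtain ⟨m, hm⟩ : ∃ m, 2 * n = m + 1 := ⟨2 * n - 1, by lia⟩
  have h_ladder : symmetryDefect (toConv ψ) (ladder (2 * n)) = 0 := by
    rw [hm, ladder_succ_eq_tree, natCast_le_antisymmetricOrder_iff.1 h_le (.ladder m)
      (by rw [RTree.size_ladder, hm]), one_apply_tree]
  rw [symmetryDefect_ladder_two_mul h_zero] at h_ladder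
  exact mul_ne_zero (pow_ne_zero _ (by norm_num)) (pow_ne_zero 2 h_ne) h_ladder

/-! ### Elementary weights -/

namespace RKScheme

open scoped Matrix

variable {s : ℕ} {Ψ : RKScheme s}

theorem character_tree (τ : RTree) : Ψ.character (tree τ) = Ψ.b ⬝ᵥ Ψ.derivativeWeight τ :=
  MvPolynomial.aeval_X _ _

theorem derivativeWeight_node (F : Forest) :
    Ψ.derivativeWeight (.node F) = (F.map fun t => Ψ.A *ᵥ Ψ.derivativeWeight t).prod := by
  ext i
  rw [derivativeWeight, RTree.fold_node, Pi.multiset_prod_apply, Multiset.map_map,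
    Multiset.map_map]
  rfl

theorem derivativeWeight_dot : Ψ.derivativeWeight (.node 0) = 1 := by
  rw [derivativeWeight_node, Multiset.map_zero, Multiset.prod_zero]

theorem derivativeWeight_node_singleton (t : RTree) :
    Ψ.derivativeWeight (.node {t}) = Ψ.A *ᵥ Ψ.derivativeWeight t := by
  rw [derivativeWeight_node, Multiset.map_singleton, Multiset.prod_singleton]

theorem derivativeWeight_corolla (n : ℕ) : Ψ.derivativeWeight (.corolla n) = Ψ.c ^ n := by
  rw [RTree.corolla, derivativeWeight_node, Multiset.map_replicate, Multiset.prod_replicate,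
    derivativeWeight_dot]
  congr
  ext i
  simp [Matrix.mulVec, dotProduct, c]

theorem IsExplicit.derivativeWeight_ladder_eq_zero (hΨ : Ψ.IsExplicit) {k : ℕ} {i : Fin s}
    (hi : i < k) : Ψ.derivativeWeight (.ladder k) i = 0 := by
  induction k generalizing i with
  | zero => exact absurd hi i.val.not_lt_zero
  | succ k ih =>
    rw [RTree.ladder_succ, derivativeWeight_node_singleton, Matrix.mulVec, dotProduct]
    refine Finset.sum_eq_zero fun j _ => ?_
    rcases le_or_gt i j with hij | hji
    · rw [hΨ i j hij, zero_mul]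
    · rw [ih (by lia), mul_zero]

theorem IsExplicit.character_ladder_eq_zero (hΨ : Ψ.IsExplicit) {k : ℕ} (hk : s < k) :
    Ψ.character (ladder k) = 0 := by
  obtain ⟨k, rfl⟩ := Nat.exists_eq_succ_of_ne_zero hk.ne_bot
  rw [ladder_succ_eq_tree, character_tree, dotProduct]
  refine Finset.sum_eq_zero fun i _ => ?_
  rw [hΨ.derivativeWeight_ladder_eq_zero (by lia), mul_zero]

end RKScheme

/-! ### Explicit three-stage schemes -/

/-- The explicit three-stage scheme with nodes `0, a, c`, matrix entry `a₃₂ = d` and weights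
`b₁, b₂, b₃`. -/
noncomputable def explicitThreeStage (a c d b₁ b₂ b₃ : ℝ) : RKScheme 3 where
  A := !![0, 0, 0; a, 0, 0; c - d, d, 0]
  b := ![b₁, b₂, b₃]

theorem isExplicit_explicitThreeStage {a c d b₁ b₂ b₃ : ℝ} :
    (explicitThreeStage a c d b₁ b₂ b₃).IsExplicit := by
  intro i j hij
  fin_cases i <;> fin_cases j <;> simp_all [explicitThreeStage]

theorem RKScheme.IsExplicit.eq_explicitThreeStage {Ψ : RKScheme 3} (h : Ψ.IsExplicit) :
    Ψ = explicitThreeStage (Ψ.c 1) (Ψ.c 2) (Ψ.A 2 1) (Ψ.b 0) (Ψ.b 1) (Ψ.b 2) := by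
  ext i j
  · fin_cases i <;> fin_cases j <;>
      simp [explicitThreeStage, RKScheme.c, Fin.sum_univ_three, h _ _ (le_refl _), h 0 1, h 0 2,
        h 1 2]
  · fin_cases i <;> simp [explicitThreeStage]

section ExplicitThreeStage

open scoped Matrix

variable {a c d b₁ b₂ b₃ : ℝ}

theorem explicitThreeStage_c : (explicitThreeStage a c d b₁ b₂ b₃).c = ![0, a, c] := by
  ext i
  fin_cases i <;> simp [RKScheme.c, explicitThreeStage, Fin.sum_univ_three]

theorem explicitThreeStage_character_corolla (n : ℕ) :
    (explicitThreeStage a c d b₁ b₂ b₃).character (tree (.corolla n)) =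
      b₁ * 0 ^ n + b₂ * a ^ n + b₃ * c ^ n := by
  rw [RKScheme.character_tree, RKScheme.derivativeWeight_corolla, explicitThreeStage_c]
  simp [explicitThreeStage, dotProduct, Fin.sum_univ_three]

theorem explicitThreeStage_character_node_corolla {n : ℕ} (hn : n ≠ 0) :
    (explicitThreeStage a c d b₁ b₂ b₃).character (tree (.node {.corolla n})) =
      b₃ * (d * a ^ n) := by
  rw [RKScheme.character_tree, RKScheme.derivativeWeight_node_singleton,
    RKScheme.derivativeWeight_corolla, explicitThreeStage_c]
  simp [explicitThreeStage, dotProduct, Matrix.mulVec, Fin.sum_univ_three, hn]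

theorem explicitThreeStage_character_node_dot_ladder_one :
    (explicitThreeStage a c d b₁ b₂ b₃).character (tree (.node {.node 0, .ladder 1})) =
      b₃ * (c * (d * a)) := by
  rw [RKScheme.character_tree, RKScheme.derivativeWeight_node, Multiset.insert_eq_cons,
    Multiset.map_cons, Multiset.map_singleton, Multiset.prod_cons, Multiset.prod_singleton,
    ← RTree.corolla_zero, ← RTree.corolla_one, RKScheme.derivativeWeight_corolla,
    RKScheme.derivativeWeight_corolla, explicitThreeStage_c]
  simp [explicitThreeStage, dotProduct, Fin.sum_univ_three, mul_comm a d]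

theorem explicitThreeStage_character_dot :
    (explicitThreeStage a c d b₁ b₂ b₃).character (tree (.node 0)) = b₁ + b₂ + b₃ := by
  simp [← RTree.corolla_zero, explicitThreeStage_character_corolla]

theorem explicitThreeStage_character_ladder_one :
    (explicitThreeStage a c d b₁ b₂ b₃).character (tree (.ladder 1)) = b₂ * a + b₃ * c := by
  simp [← RTree.corolla_one, explicitThreeStage_character_corolla]

theorem explicitThreeStage_character_ladder_two :
    (explicitThreeStage a c d b₁ b₂ b₃).character (tree (.ladder 2)) = b₃ * d * a := by
  rw [RTree.ladder_succ, ← RTree.corolla_one,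
    explicitThreeStage_character_node_corolla one_ne_zero, pow_one, mul_assoc]

theorem two_le_order_explicitThreeStage_iff :
    2 ≤ order (explicitThreeStage a c d b₁ b₂ b₃).character ↔
      b₁ + b₂ + b₃ = 1 ∧ b₂ * a + b₃ * c = 1 / 2 := by
  rw [two_le_order_iff, explicitThreeStage_character_dot, explicitThreeStage_character_ladder_one]

theorem five_le_antisymmetricOrder_explicitThreeStage_iff
    (h_order : 2 ≤ order (explicitThreeStage a c d b₁ b₂ b₃).character) :
    5 ≤ antisymmetricOrder (explicitThreeStage a c d b₁ b₂ b₃).character ↔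
      b₃ * d * a = 1 / 8 ∧
      2 * (b₃ * d * a ^ 2) = b₂ * a ^ 2 + b₃ * c ^ 2 - 1 / 4 ∧
      2 * (b₃ * c * d * a) = b₂ * a ^ 2 + b₃ * c ^ 2 - 1 / 8 ∧
      2 * (b₂ * a ^ 3 + b₃ * c ^ 3) = 3 * (b₂ * a ^ 2 + b₃ * c ^ 2) - 1 / 2 := by
  obtain ⟨h_dot, h_one⟩ := two_le_order_iff.1 h_order
  have h_three : (explicitThreeStage a c d b₁ b₂ b₃).character (tree (.ladder 3)) = 0 := by
    rw [← ladder_succ_eq_tree,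
      isExplicit_explicitThreeStage.character_ladder_eq_zero (Nat.lt_succ_self 3)]
  rw [five_le_antisymmetricOrder_iff h_dot h_one, h_three, explicitThreeStage_character_ladder_two,
    explicitThreeStage_character_node_corolla two_ne_zero,
    explicitThreeStage_character_node_dot_ladder_one, explicitThreeStage_character_corolla,
    explicitThreeStage_character_corolla]
  constructor <;> rintro ⟨h_ladder, h_cherry, h_bush, h_corolla⟩
  · refine ⟨?_, ?_, ?_, ?_⟩ <;> linarith
  · refine ⟨?_, ?_, ?_, ?_⟩ <;> linarith

theorem explicitThreeStage_mem_EESClass_iff :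
    explicitThreeStage a c d b₁ b₂ b₃ ∈ EESClass 3 2 5 ↔
      (b₁ + b₂ + b₃ = 1 ∧ b₂ * a + b₃ * c = 1 / 2) ∧
      b₃ * d * a = 1 / 8 ∧
      2 * (b₃ * d * a ^ 2) = b₂ * a ^ 2 + b₃ * c ^ 2 - 1 / 4 ∧
      2 * (b₃ * c * d * a) = b₂ * a ^ 2 + b₃ * c ^ 2 - 1 / 8 ∧
      2 * (b₂ * a ^ 3 + b₃ * c ^ 3) = 3 * (b₂ * a ^ 2 + b₃ * c ^ 2) - 1 / 2 := by
  set Ψ := explicitThreeStage a c d b₁ b₂ b₃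
  have h_explicit : Ψ.IsExplicit := isExplicit_explicitThreeStage
  simp only [EESClass, Set.mem_ofPred_eq, eq_natCast_iff_le_and_lt]
  constructor
  · rintro ⟨-, ⟨h_two, -⟩, h_five, -⟩
    exact ⟨two_le_order_explicitThreeStage_iff.1 h_two,
      (five_le_antisymmetricOrder_explicitThreeStage_iff h_two).1 h_five⟩
  · rintro ⟨h_consistent, h_conditions⟩
    have h_two : 2 ≤ order Ψ.character := two_le_order_explicitThreeStage_iff.2 h_consistent
    have h_ladder : Ψ.character (tree (.ladder 2)) = 1 / 8 :=
      explicitThreeStage_character_ladder_two.trans h_conditions.1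
    have h_ladder_ne : Ψ.character (ladder 3) ≠ 0 := by
      rw [ladder_succ_eq_tree, h_ladder]
      norm_num
    exact ⟨h_explicit, ⟨h_two, order_lt_three (by rw [h_ladder]; norm_num)⟩,
      (five_le_antisymmetricOrder_explicitThreeStage_iff h_two).2 h_conditions,
      antisymmetricOrder_lt_two_mul three_ne_zero h_ladder_ne
        fun k => h_explicit.character_ladder_eq_zero⟩

end ExplicitThreeStage

/-! ### The order conditions of `EES(2, 5)` -/

section OrderConditions

variable {K : Type*} [Field K] [CharZero K] {a c d b₁ b₂ b₃ x : K}

theorem orderConditions_iff :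
    ((b₁ + b₂ + b₃ = 1 ∧ b₂ * a + b₃ * c = 1 / 2) ∧
      b₃ * d * a = 1 / 8 ∧
      2 * (b₃ * d * a ^ 2) = b₂ * a ^ 2 + b₃ * c ^ 2 - 1 / 4 ∧
      2 * (b₃ * c * d * a) = b₂ * a ^ 2 + b₃ * c ^ 2 - 1 / 8 ∧
      2 * (b₂ * a ^ 3 + b₃ * c ^ 3) = 3 * (b₂ * a ^ 2 + b₃ * c ^ 2) - 1 / 2) ↔
    b₂ = 1 / 2 ∧ b₃ = 1 / 2 - b₁ ∧ c = a + 1 / 2 ∧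
      4 * (1 - b₁) * a = 1 + 2 * b₁ ∧ (1 / 2 - b₁) * d * a = 1 / 8 := by
  constructor
  · rintro ⟨⟨h_dot, h_one⟩, h_two, h_cherry, h_bush, -⟩
    have hc : c = a + 1 / 2 := by
      linear_combination 4 * h_bush - 4 * h_cherry - 8 * (c - a) * h_two
    subst hc
    have ha : a ≠ 0 := by
      rintro rfl
      norm_num at h_two
    have h_third : b₃ * (a + 1 / 2) = (1 - a) / 2 := by
      linear_combination -2 * h_cherry + 4 * a * h_two - 2 * a * h_one
    have hb₂ : b₂ = 1 / 2 := mul_right_cancel₀ ha (by linear_combination h_one - h_third)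
    have hb₃ : b₃ = 1 / 2 - b₁ := by linear_combination h_dot - hb₂
    subst hb₂ hb₃
    exact ⟨rfl, rfl, rfl, by linear_combination 4 * h_third, h_two⟩
  · rintro ⟨rfl, rfl, rfl, ha, hd⟩
    have h_third : (1 / 2 - b₁) * (a + 1 / 2) = (1 - a) / 2 := by linear_combination ha / 4
    refine ⟨⟨by ring, by linear_combination h_third⟩, hd, ?_, ?_, ?_⟩
    · linear_combination 2 * a * hd - (a + 1 / 2) * h_third
    · linear_combination 2 * (a + 1 / 2) * hd - (a + 1 / 2) * h_third
    · linear_combination (2 * (a + 1 / 2) ^ 2 - 3 * (a + 1 / 2)) * h_third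

theorem one_sub_four_mul_sq_ne_zero (h_half : x ≠ 1 / 2) (h_neg_half : x ≠ -(1 / 2)) :
    1 - 4 * x ^ 2 ≠ 0 := by
  rw [show 1 - 4 * x ^ 2 = 4 * (1 / 2 - x) * (x - -(1 / 2)) by ring]
  exact mul_ne_zero (mul_ne_zero (by norm_num) (sub_ne_zero.2 h_half.symm))
    (sub_ne_zero.2 h_neg_half)

theorem tableau_coefficients_iff :
    (c = a + 1 / 2 ∧ 4 * (1 - x) * a = 1 + 2 * x ∧ (1 / 2 - x) * d * a = 1 / 8) ↔
      (x ≠ 1 ∧ x ≠ 1 / 2 ∧ x ≠ -(1 / 2)) ∧ a = (1 + 2 * x) / (4 * (1 - x)) ∧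
        c = 3 / (4 * (1 - x)) ∧ d = (1 - x) / (1 - 4 * x ^ 2) := by
  constructor
  · rintro ⟨rfl, ha, hd⟩
    have h1 : x ≠ 1 := by
      rintro rfl
      norm_num at ha
    have h2 : x ≠ 1 / 2 := by
      rintro rfl
      norm_num at hd
    have h3 : x ≠ -(1 / 2) := by
      rintro rfl
      obtain rfl : a = 0 := by linear_combination (1 / 6) * ha
      norm_num at hd
    have h_nodes : 4 * (1 - x) ≠ 0 := by simpa [sub_eq_zero] using h1.symm
    have h_entry := one_sub_four_mul_sq_ne_zero h2 h3
    refine ⟨⟨h1, h2, h3⟩, ?_, ?_, ?_⟩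
    · rw [eq_div_iff h_nodes]
      linear_combination ha
    · rw [eq_div_iff h_nodes]
      linear_combination ha
    · rw [eq_div_iff h_entry]
      linear_combination 8 * (1 - x) * hd - 2 * (1 / 2 - x) * d * ha
  · rintro ⟨⟨h1, h2, h3⟩, ha, hc, hd⟩
    have h_nodes : 4 * (1 - x) ≠ 0 := by simpa [sub_eq_zero] using h1.symm
    have h_entry := one_sub_four_mul_sq_ne_zero h2 h3
    rw [eq_div_iff h_nodes] at ha hc
    rw [eq_div_iff h_entry] at hd
    refine ⟨mul_right_cancel₀ h_nodes ?_, ?_, mul_right_cancel₀ h_nodes ?_⟩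
    · linear_combination hc - ha
    · linear_combination ha
    · linear_combination (1 / 2 - x) * d * ha + hd / 2

end OrderConditions

section EES25

variable {x : ℝ}

theorem EES25_eq_explicitThreeStage (h1 : x ≠ 1) (h2 : x ≠ 1 / 2) (h3 : x ≠ -(1 / 2)) :
    EES25 x = explicitThreeStage ((1 + 2 * x) / (4 * (1 - x))) (3 / (4 * (1 - x)))
      ((1 - x) / (1 - 4 * x ^ 2)) x (1 / 2) (1 / 2 - x) := by
  have h_nodes : 1 - x ≠ 0 := sub_ne_zero.2 h1.symm
  have h_entry := one_sub_four_mul_sq_ne_zero h2 h3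
  have h_difference : (4 * x - 1) ^ 2 / (4 * (x - 1) * (1 - 4 * x ^ 2)) =
      3 / (4 * (1 - x)) - (1 - x) / (1 - 4 * x ^ 2) := by
    rw [← neg_sub 1 x]
    field_simp
    ring
  rw [EES25, h_difference]
  rfl

theorem EES25_c (h1 : x ≠ 1) (h2 : x ≠ 1 / 2) (h3 : x ≠ -(1 / 2)) :
    (EES25 x).c = ![0, (1 + 2 * x) / (4 * (1 - x)), 3 / (4 * (1 - x))] := by
  rw [EES25_eq_explicitThreeStage h1 h2 h3, explicitThreeStage_c]

theorem mem_EESClass_three_two_five_iff {Ψ : RKScheme 3} :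
    Ψ ∈ EESClass 3 2 5 ↔ ∃ x : ℝ, x ≠ 1 ∧ x ≠ 1 / 2 ∧ x ≠ -(1 / 2) ∧ Ψ = EES25 x := by
  constructor
  · intro hΨ
    have h_eq := RKScheme.IsExplicit.eq_explicitThreeStage hΨ.1
    rw [h_eq, explicitThreeStage_mem_EESClass_iff, orderConditions_iff,
      tableau_coefficients_iff] at hΨ
    obtain ⟨hb₂, hb₃, ⟨h1, h2, h3⟩, ha, hc, hd⟩ := hΨ
    refine ⟨Ψ.b 0, h1, h2, h3, ?_⟩
    rw [EES25_eq_explicitThreeStage h1 h2 h3, ← ha, ← hc, ← hd, ← hb₃, ← hb₂]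
    exact h_eq
  · rintro ⟨x, h1, h2, h3, rfl⟩
    rw [EES25_eq_explicitThreeStage h1 h2 h3, explicitThreeStage_mem_EESClass_iff,
      orderConditions_iff, tableau_coefficients_iff]
    exact ⟨rfl, rfl, ⟨h1, h2, h3⟩, rfl, rfl, rfl⟩

end EES25

end EES

theorem mainTheorem7 :
    EES.EESClass 3 2 5 = {Ψ | ∃ x : ℝ, x ≠ 1 ∧ x ≠ 1 / 2 ∧ x ≠ -(1 / 2) ∧ Ψ = EES.EES25 x} ∧
    (∀ x : ℝ, x ≠ 1 → x ≠ 1 / 2 → x ≠ -(1 / 2) →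
      (EES.EES25 x).c = ![0, (1 + 2 * x) / (4 * (1 - x)), 3 / (4 * (1 - x))]) ∧
    (EES.EES25 (1 / 4) = ⟨!![0, 0, 0; 1 / 2, 0, 0; 0, 1, 0], ![1 / 4, 1 / 2, 1 / 4]⟩ ∧
      (EES.EES25 (1 / 4)).c = ![0, 1 / 2, 1]) ∧
    (EES.EES25 (1 / 10) =
        ⟨!![0, 0, 0; 1 / 3, 0, 0; -(5 / 48), 15 / 16, 0], ![1 / 10, 1 / 2, 2 / 5]⟩ ∧
      (EES.EES25 (1 / 10)).c = ![0, 1 / 3, 5 / 6]) := by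
  refine ⟨Set.ext fun Ψ => EES.mem_EESClass_three_two_five_iff, fun x => EES.EES25_c,
    ⟨?_, ?_⟩, ?_, ?_⟩
  · rw [EES.EES25]; norm_num
  · rw [EES.EES25_c (by norm_num) (by norm_num) (by norm_num)]; norm_num
  · rw [EES.EES25]; norm_num
  · rw [EES.EES25_c (by norm_num) (by norm_num) (by norm_num)]; norm_num
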